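/- **Proposition (Marschall's inequality).** Let $n\ge 1$ and let $\mathcal F u(\xi)=\int_{\mathbb R^n}e^{-i x\cdot\xi}u(x)\,dx$ denote the Fourier transformation on $\mathcal S'(\mathbb R^n)$. For a symbol $b\in\mathcal S'(\mathbb R^{2n})$, the distribution kernel of $b(x,D)$ is $K(x,y)=\mathcal F^{-1}_{\xi\to z}b(x,\xi)\big|_{z=x-y}\in\mathcal S'(\mathbb R^{2n})$. Fix $\Psi\in C^\infty(\mathbb R,\mathbb R)$ with $\Psi(s)=1$ for $s\le\frac{11}{10}$ and $\Psi(s)=0$ for $s\ge\frac{13}{10}$, and put $\varphi_j(\xi)=\Psi(2^{-j}|\xi|)-\Psi(2^{1-j}|\xi|)$ for $j\in\mathbb Z$ (a partition of unity on $\mathbb R^n\setminus\{0\}$). Define $$\|f\|_{\dot B^{s}_{p,q}}=\Bigl(\sum_{j\in\mathbb Z}2^{sjq}\,\|\mathcal F^{-1}(\varphi_j\mathcal Ff)\|_{L_p}^q\Bigr)^{1/q},\qquad M_tf(x)=\sup_{r>0}\Bigl(\frac1{|B(x,r)|}\int_{B(x,r)}|f(y)|^t\,dy\Bigr)^{1/t},$$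 both with values in $[0,\infty]$, and with the convention $0\cdot\infty=0$ for products. Let $k\in\mathbb Z$, let $b\in\mathcal S'(\mathbb R^{2n})\cap L_1^{\mathrm{loc}}(\mathbb R^{2n})$ and $v\in\mathcal S'(\mathbb R^n)$, and suppose that, $B(0,2^k)$ being the closed ball in $\mathbb R^n$, $$\operatorname{supp}\mathcal Fv\subset B(0,2^k),\qquad \operatorname{supp}b\subset\mathbb R^n\times B(0,2^k).$$ Then: 1. The distribution kernel $K$ of $b(x,D)$ is a locally integrable function, i.e. $K\in L_1^{\mathrm{loc}}(\mathbb R^{2n})\cap\mathcal S'(\mathbb R^{2n})$; and $v$ is a locally integrable function. 2. If for some $t\in\,]0,1]$ the function $x\mapsto M_tv(x)\cdot\|b(x,2^k\cdot)\|_{\dot B^{n/t}_{1,t}(\mathbb R^n)}$ belongs to $L_1^{\mathrm{loc}}(\mathbb R^n)$, then $K(x,\cdot)v(\cdot)\in L_1(\mathbb R^n)$ for a.e. $x\in\mathbb R^n$; the action of $b(x,D)$ on $v$, defined by $$b(x,D)v(x):=\int_{\mathbb R^n}K(x,y)v(y)\,dy,$$ is a function in $L_1^{\mathrm{loc}}(\mathbb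 R^n)$; and for a.e. $x\in\mathbb R^n$ $$|b(x,D)v(x)|\le c\,\|b(x,2^k\cdot)\|_{\dot B^{n/t}_{1,t}(\mathbb R^n)}\,M_tv(x),$$ where the constant $c$ depends only on $n$, $t$ and $\Psi$; in particular it is independent of $k$, $b$ and $v$. -/

import Mathlib

open MeasureTheory Filter Topology Set SchwartzMap FourierTransform TemperedDistribution Distribution
open scoped NNReal ENNReal ContDiff

set_option linter.unusedSectionVars false

/-! ### The partial Fourier transform of Schwartz functions of two variables -/

namespace PartialFourier

open LineDeriv

variable {E : Type} [NormedAddCommGroup E] [InnerProductSpace ℝ E] [FiniteDimensional ℝ E]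
  [MeasurableSpace E] [BorelSpace E]

/-- The slice `ψ(x, ·)` of a Schwartz function of two variables. -/
noncomputable def slice (x : E) : 𝓢(E × E, ℂ) →L[ℂ] 𝓢(E, ℂ) :=
  SchwartzMap.compCLM ℂ (g := fun y : E => (x, y))
    (by
      have h : (fun y : E => (x, y)) = fun y : E => (x, (0 : E)) + ContinuousLinearMap.inr ℝ E E y := by
        ext y <;> simp
      rw [h]
      exact (Function.HasTemperateGrowth.const _).add
        (ContinuousLinearMap.hasTemperateGrowth _))
    ⟨1, 1, fun y => by
      have : ‖y‖ ≤ ‖(x, y)‖ := le_max_right _ _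
      simp only [pow_one, one_mul]; linarith⟩

lemma slice_apply (x : E) (ψ : 𝓢(E × E, ℂ)) (y : E) : slice x ψ y = ψ (x, y) := rfl

/-- The Fourier transform in the second variable. -/
noncomputable def G (ψ : 𝓢(E × E, ℂ)) (p : E × E) : ℂ := 𝓕 (slice p.1 ψ) p.2

lemma G_eq (ψ : 𝓢(E × E, ℂ)) (p : E × E) :
    G ψ p = ∫ y, Real.fourierChar (-inner ℝ y p.2) • ψ (p.1, y) := by
  rw [G, SchwartzMap.fourier_coe, Real.fourier_eq]; rfl

lemma G_integrable (φ : 𝓢(E × E, ℂ)) (q : E × E) :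
    Integrable (fun y => Real.fourierChar (-inner ℝ y q.2) • φ (q.1, y)) :=
  (Real.fourierIntegral_convergent_iff (f := fun y => φ (q.1, y)) (μ := volume) q.2).2
      ((slice q.1 φ).integrable)

lemma G_add (φ ψ : 𝓢(E × E, ℂ)) (p : E × E) : G (φ + ψ) p = G φ p + G ψ p := by
  simp [G, FourierTransform.fourier_add]

lemma G_smul (c : ℂ) (ψ : 𝓢(E × E, ℂ)) (p : E × E) : G (c • ψ) p = c * G ψ p := by
  simp [G, FourierTransform.fourier_smul]

lemma G_sum {ι : Type} (s : Finset ι) (f : ι → 𝓢(E × E, ℂ)) (p : E × E) :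
    G (∑ i ∈ s, f i) p = ∑ i ∈ s, G (f i) p := by
  classical
  induction s using Finset.induction_on with
  | empty => have := G_smul 0 (0 : 𝓢(E × E, ℂ)) p; simpa using this
  | insert a s ha ih => rw [Finset.sum_insert ha, Finset.sum_insert ha, G_add, ih]

/-- The operator with `∂_m (G ψ) = G (D m ψ)`. -/
noncomputable def D (m : E × E) : 𝓢(E × E, ℂ) →L[ℂ] 𝓢(E × E, ℂ) :=
  lineDerivOpCLM ℂ 𝓢(E × E, ℂ) ((m.1, 0) : E × E) +
  (-(2 * Real.pi * Complex.I)) • SchwartzMap.smulLeftCLM (𝕜 := ℂ) ℂ (fun p : E × E => ((inner ℝ p.2 m.2 : ℝ) : ℂ))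

lemma tg_inner (c : E) : (fun p : E × E => ((inner ℝ p.2 c : ℝ) : ℂ)).HasTemperateGrowth :=
  (Complex.ofRealCLM ∘L ((innerSL ℝ).flip c) ∘L (ContinuousLinearMap.snd ℝ E E)).hasTemperateGrowth

lemma D_apply (m : E × E) (ψ : 𝓢(E × E, ℂ)) (p : E × E) :
    D m ψ p = fderiv ℝ ψ p (m.1, 0) - 2 * Real.pi * Complex.I * (inner ℝ p.2 m.2 * ψ p) := by
  simp [D, SchwartzMap.lineDerivOp_apply_eq_fderiv, SchwartzMap.smulLeftCLM_apply_apply (tg_inner m.2)]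
  ring

lemma slice_bound (ψ : 𝓢(E × E, ℂ)) (k : ℕ) : ∃ b : E → ℝ, Integrable b ∧
    ∀ x y, (1 + ‖y‖) ^ k * (‖ψ (x, y)‖ + ‖fderiv ℝ ψ (x, y)‖) ≤ b y := by
  set N := (volume : Measure E).integrablePower + k with hN
  set C := (2 ^ N * ((Finset.Iic (N, 1)).sup (fun m => SchwartzMap.seminorm ℝ m.1 m.2)) ψ) with hC
  refine ⟨fun y => (2 * C) * (1 + ‖y‖) ^ (-((volume : Measure E).integrablePower : ℝ)),
    (Measure.integrable_pow_neg_integrablePower volume).const_mul _, ?_⟩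
  intro x y
  have h0 := SchwartzMap.one_add_le_sup_seminorm_apply (𝕜 := ℝ) (m := (N, 1)) (k := N) (n := 0)
    le_rfl zero_le_one ψ (x, y)
  have h1 := SchwartzMap.one_add_le_sup_seminorm_apply (𝕜 := ℝ) (m := (N, 1)) (k := N) (n := 1)
    le_rfl le_rfl ψ (x, y)
  rw [norm_iteratedFDeriv_zero] at h0
  rw [norm_iteratedFDeriv_one] at h1
  have h2 : (1 + ‖y‖) ^ N ≤ (1 + ‖(x, y)‖) ^ N := by
    gcongr; exact le_max_right _ _
  beta_reduce
  rw [Real.rpow_neg (by positivity), Real.rpow_natCast, ← div_eq_mul_inv, le_div_iff₀ (by positivity)]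
  calc _ = (1 + ‖y‖) ^ N * (‖ψ (x, y)‖ + ‖fderiv ℝ ψ (x, y)‖) := by rw [hN, pow_add]; ring
    _ ≤ (1 + ‖(x, y)‖) ^ N * (‖ψ (x, y)‖ + ‖fderiv ℝ ψ (x, y)‖) := by gcongr
    _ ≤ 2 * C := by simp only [hC]; simp only at h0 h1; linarith

lemma hasFDerivAt_param {P : Type} [NormedAddCommGroup P] [NormedSpace ℝ P] (a c : P →L[ℝ] E)
    (ψ : 𝓢(E × E, ℂ)) (p : P) :
    ∃ L : P →L[ℝ] ℂ, HasFDerivAt (fun p => G ψ (a p, c p)) L p ∧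
      ∀ m, L m = G (D (a m, c m) ψ) (a p, c p) := by
  obtain ⟨b, hb, hb'⟩ := slice_bound ψ 1
  let J : P →L[ℝ] E × E := (ContinuousLinearMap.inl ℝ E E) ∘L a
  let F' : P → E → (P →L[ℝ] ℂ) := fun q y =>
    (Real.fourierChar (-inner ℝ y (c q)) : ℂ) • ((fderiv ℝ ψ (a q, y)) ∘L J) +
    ((-2 * Real.pi * Complex.I * Real.fourierChar (-inner ℝ y (c q)) * ψ (a q, y) : ℂ)) •
      (Complex.ofRealCLM ∘L (innerSL ℝ y) ∘L c)
  have hcont : Continuous fun y => F' p y := by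
    have h1 : Continuous fun y => fderiv ℝ ψ (a p, y) :=
      ((ψ.smooth 1).continuous_fderiv one_ne_zero).comp (by fun_prop)
    have h2 : Continuous fun y : E => (Real.fourierChar (-inner ℝ y (c p)) : ℂ) :=
      continuous_subtype_val.comp (Real.continuous_fourierChar.comp (by fun_prop))
    have h3 : Continuous fun y => ψ (a p, y) := ψ.continuous.comp (by fun_prop)
    have h4 : Continuous fun y : E => innerSL ℝ y := (innerSL ℝ).continuous
    simp only [F']
    fun_prop
  have hJ : ∀ m, ‖J m‖ ≤ ‖a‖ * ‖m‖ := fun m => by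
    simpa [J, Prod.norm_def] using a.le_opNorm m
  have hbd : ∀ q y, ‖F' q y‖ ≤ (‖a‖ + 2 * Real.pi * ‖c‖) * b y := by
    intro q y
    have hy := hb' (a q) y
    rw [pow_one] at hy
    have h0 : 0 ≤ b y := le_trans (by positivity) hy
    refine ContinuousLinearMap.opNorm_le_bound _ (by positivity) fun m => ?_
    have e1 : ‖fderiv ℝ ψ (a q, y) (J m)‖ ≤ ‖fderiv ℝ ψ (a q, y)‖ * (‖a‖ * ‖m‖) :=
      (ContinuousLinearMap.le_opNorm _ _).trans (by gcongr; exact hJ m)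
    have e2 : ‖(inner ℝ y (c m) : ℝ)‖ ≤ ‖y‖ * (‖c‖ * ‖m‖) :=
      (norm_inner_le_norm _ _).trans (by gcongr; exact c.le_opNorm m)
    have e3 : ‖fderiv ℝ ψ (a q, y)‖ ≤ b y := by
      refine le_trans ?_ hy
      nlinarith [norm_nonneg y, norm_nonneg (ψ (a q, y)), norm_nonneg (fderiv ℝ ψ (a q, y)),
        mul_nonneg (norm_nonneg y) (norm_nonneg (ψ (a q, y))),
        mul_nonneg (norm_nonneg y) (norm_nonneg (fderiv ℝ ψ (a q, y)))]
    have e4 : ‖y‖ * ‖ψ (a q, y)‖ ≤ b y := by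
      refine le_trans ?_ hy
      nlinarith [norm_nonneg y, norm_nonneg (ψ (a q, y)), norm_nonneg (fderiv ℝ ψ (a q, y)),
        mul_nonneg (norm_nonneg y) (norm_nonneg (fderiv ℝ ψ (a q, y)))]
    have e5 : F' q y m = (Real.fourierChar (-inner ℝ y (c q)) : ℂ) *
        ((fderiv ℝ ψ (a q, y) (J m)) +
          (-2 * Real.pi * Complex.I * (ψ (a q, y) * (inner ℝ y (c m) : ℝ)))) := by
      simp [F']; ring
    rw [e5, norm_mul, Circle.norm_coe, one_mul]
    refine (norm_add_le _ _).trans ?_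
    have e6 : ‖(-2 * Real.pi * Complex.I * (ψ (a q, y) * (inner ℝ y (c m) : ℝ)) : ℂ)‖ =
        2 * Real.pi * (‖ψ (a q, y)‖ * ‖(inner ℝ y (c m) : ℝ)‖) := by
      simp [Real.pi_nonneg, abs_of_nonneg]
    rw [e6]
    calc _ ≤ ‖fderiv ℝ ψ (a q, y)‖ * (‖a‖ * ‖m‖) +
          2 * Real.pi * (‖ψ (a q, y)‖ * (‖y‖ * (‖c‖ * ‖m‖))) := by gcongr
      _ = ‖fderiv ℝ ψ (a q, y)‖ * (‖a‖ * ‖m‖) +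
          2 * Real.pi * ((‖y‖ * ‖ψ (a q, y)‖) * (‖c‖ * ‖m‖)) := by ring
      _ ≤ b y * (‖a‖ * ‖m‖) + 2 * Real.pi * (b y * (‖c‖ * ‖m‖)) := by gcongr
      _ = _ := by ring
  have hG : ∀ (φ : 𝓢(E × E, ℂ)), (fun p : P => G φ (a p, c p)) =
      fun p : P => ∫ y, Real.fourierChar (-inner ℝ y (c p)) • φ (a p, y) :=
    fun φ => funext fun q => G_eq φ (a q, c q)
  have hd := hasFDerivAt_integral_of_dominated_of_fderiv_le (𝕜 := ℝ) (s := univ) (μ := volume)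
    (x₀ := p) univ_mem
    (F := fun (p : P) y => Real.fourierChar (-inner ℝ y (c p)) • ψ (a p, y))
    (F' := F')
    (Eventually.of_forall fun q => (G_integrable ψ (a q, c q)).aestronglyMeasurable)
    (G_integrable ψ (a p, c p))
    hcont.aestronglyMeasurable (Eventually.of_forall fun y q _ => hbd q y)
    (hb.const_mul _)
    (Eventually.of_forall fun y q _ => ?_)
  · rw [hG]
    refine ⟨_, hd, fun m => ?_⟩
    have hi : Integrable (F' p) := Integrable.mono' (hb.const_mul _) hcont.aestronglyMeasurable
      (Eventually.of_forall fun y => hbd p y)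
    rw [ContinuousLinearMap.integral_apply hi, G_eq]
    refine integral_congr_ae (Eventually.of_forall fun y => ?_)
    simp [F', J, D_apply, Circle.smul_def]
    ring
  · have h1 : HasFDerivAt (fun q : P => (Real.fourierChar (-(innerSL ℝ y) (c q)) : ℂ)) _ q :=
      (Real.hasFDerivAt_fourierChar_neg_bilinear_right (innerSL ℝ) y (c q)).comp q
        c.hasFDerivAt
    have h2 : HasFDerivAt (fun q : P => ψ (a q, y)) ((fderiv ℝ ψ (a q, y)) ∘L J) q := by
      refine (ψ.hasFDerivAt (a q, y)).comp q ?_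
      have := J.hasFDerivAt (x := q) |>.add_const ((0, y) : E × E)
      refine this.congr_of_eventuallyEq (Eventually.of_forall fun r => ?_)
      simp [J]
    refine (h1.smul h2).congr_fderiv (ContinuousLinearMap.ext fun r => ?_)
    simp [F', innerSL_apply_apply ℝ]
    ring

lemma hasFDerivAt_G (ψ : 𝓢(E × E, ℂ)) (p : E × E) :
    ∃ L : E × E →L[ℝ] ℂ, HasFDerivAt (G ψ) L p ∧ ∀ m, L m = G (D m ψ) p :=
  hasFDerivAt_param (ContinuousLinearMap.fst ℝ E E) (ContinuousLinearMap.snd ℝ E E) ψ p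

lemma fderiv_G_sum {ι : Type} [Fintype ι] (B : Module.Basis ι ℝ (E × E)) (ψ : 𝓢(E × E, ℂ)) :
    fderiv ℝ (G ψ) = fun p => ∑ i, (ContinuousLinearMap.smulRightL ℝ (E × E) ℂ
      (LinearMap.toContinuousLinearMap (B.coord i))) (G (D (B i) ψ) p) := by
  funext p
  obtain ⟨L, hL, hm⟩ := hasFDerivAt_G ψ p
  rw [hL.fderiv]
  refine ContinuousLinearMap.coe_injective (B.ext fun i => ?_)
  classical
  simp only [ContinuousLinearMap.coe_coe, hm, ContinuousLinearMap.toLinearMap_sum, LinearMap.coe_sum,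
    Finset.sum_apply, ContinuousLinearMap.smulRightL_apply_apply,
    ContinuousLinearMap.smulRight_apply, LinearMap.coe_toContinuousLinearMap',
    Module.Basis.coord_apply, Module.Basis.repr_self, Finsupp.single_apply]
  simp

lemma contDiff_G_nat (n : ℕ) : ∀ ψ : 𝓢(E × E, ℂ), ContDiff ℝ n (G ψ) := by
  have B := Module.finBasis ℝ (E × E)
  induction n with
  | zero =>
    intro ψ
    refine contDiff_zero.2 (continuous_iff_continuousAt.2 fun p => ?_)
    obtain ⟨L, hL, -⟩ := hasFDerivAt_G ψ p
    exact hL.continuousAt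
  | succ n ih =>
    intro ψ
    rw [Nat.cast_succ, contDiff_succ_iff_fderiv]
    refine ⟨fun p => ?_, by simp, ?_⟩
    · obtain ⟨L, hL, -⟩ := hasFDerivAt_G ψ p
      exact hL.differentiableAt
    · rw [fderiv_G_sum B]
      exact ContDiff.sum fun i _ => (ContinuousLinearMap.contDiff _).comp (ih _)

lemma contDiff_G (ψ : 𝓢(E × E, ℂ)) : ContDiff ℝ ∞ (G ψ) :=
  contDiff_infty.2 fun n => contDiff_G_nat n ψ

/-- The operator with `(1 + ‖x‖² + ‖ξ‖²) G ψ = G (W ψ)`. -/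
noncomputable def W : 𝓢(E × E, ℂ) →L[ℂ] 𝓢(E × E, ℂ) :=
  ContinuousLinearMap.id ℂ _ +
  (SchwartzMap.smulLeftCLM (𝕜 := ℂ) ℂ (fun p : E × E => ((‖p.1‖ ^ 2 : ℝ) : ℂ))) +
  (-(4 * (Real.pi : ℂ) ^ 2)⁻¹) • ∑ i, lineDerivOpCLM ℂ 𝓢(E × E, ℂ) ((0, stdOrthonormalBasis ℝ E i) : E × E) ∘L
    lineDerivOpCLM ℂ 𝓢(E × E, ℂ) ((0, stdOrthonormalBasis ℝ E i) : E × E)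

lemma tg_fst : (fun p : E × E => ((‖p.1‖ ^ 2 : ℝ) : ℂ)).HasTemperateGrowth := by
  have h1 : (fun p : E × E => (‖p.1‖ ^ 2 : ℝ)).HasTemperateGrowth :=
    (Function.hasTemperateGrowth_norm_sq (H := E)).comp
      (ContinuousLinearMap.fst ℝ E E).hasTemperateGrowth
  exact Complex.ofRealCLM.hasTemperateGrowth.comp h1

lemma G_lineDeriv (m : E) (ψ : 𝓢(E × E, ℂ)) (p : E × E) :
    G (∂_{((0, m) : E × E)} ψ) p = 2 * Real.pi * Complex.I * (inner ℝ p.2 m * G ψ p) := by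
  have h : slice p.1 (∂_{((0, m) : E × E)} ψ) = ∂_{m} (slice p.1 ψ) := by
    ext y
    rw [slice_apply, SchwartzMap.lineDerivOp_apply, SchwartzMap.lineDerivOp_apply]
    simp only [lineDeriv, slice_apply]
    congr 1
    ext t
    simp
  have hg : (fun x : E => inner ℝ x m).HasTemperateGrowth := by fun_prop
  rw [G, h, SchwartzMap.fourier_lineDerivOp_eq]
  simp [SchwartzMap.smulLeftCLM_apply_apply hg, G]

lemma G_W (ψ : 𝓢(E × E, ℂ)) (p : E × E) :
    G (W ψ) p = (1 + ‖p.1‖ ^ 2 + ‖p.2‖ ^ 2) * G ψ p := by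
  have h1 : G (SchwartzMap.smulLeftCLM (𝕜 := ℂ) ℂ (fun p : E × E => ((‖p.1‖ ^ 2 : ℝ) : ℂ)) ψ) p =
      ‖p.1‖ ^ 2 * G ψ p := by
    have : slice p.1 (SchwartzMap.smulLeftCLM (𝕜 := ℂ) ℂ
        (fun p : E × E => ((‖p.1‖ ^ 2 : ℝ) : ℂ)) ψ) = ((‖p.1‖ ^ 2 : ℝ) : ℂ) • slice p.1 ψ := by
      ext y
      rw [slice_apply, SchwartzMap.smulLeftCLM_apply_apply tg_fst]
      rfl
    rw [G, this, FourierTransform.fourier_smul]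
    simp [G]
  have h2 : ∑ i, inner ℝ p.2 (stdOrthonormalBasis ℝ E i) ^ 2 = ‖p.2‖ ^ 2 :=
    (stdOrthonormalBasis ℝ E).sum_sq_inner_left p.2
  have h3 : G (∑ i, ∂_{((0, stdOrthonormalBasis ℝ E i) : E × E)}
      (∂_{((0, stdOrthonormalBasis ℝ E i) : E × E)} ψ)) p =
      -(4 * (Real.pi : ℂ) ^ 2) * (((‖p.2‖ ^ 2 : ℝ) : ℂ) * G ψ p) := by
    rw [G_sum]
    simp only [G_lineDeriv]
    rw [← h2]
    push_cast
    rw [Finset.sum_mul, Finset.mul_sum]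
    refine Finset.sum_congr rfl fun i _ => ?_
    linear_combination (4 * Real.pi ^ 2 * (inner ℝ p.2 (stdOrthonormalBasis ℝ E i)) ^ 2 * G ψ p) *
      Complex.I_sq
  have hW : W ψ = ψ + SchwartzMap.smulLeftCLM (𝕜 := ℂ) ℂ (fun p : E × E => ((‖p.1‖ ^ 2 : ℝ) : ℂ)) ψ +
      (-(4 * (Real.pi : ℂ) ^ 2)⁻¹) • ∑ i, ∂_{((0, stdOrthonormalBasis ℝ E i) : E × E)}
      (∂_{((0, stdOrthonormalBasis ℝ E i) : E × E)} ψ) := by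
    simp only [W, add_apply, smul_apply, sum_apply]; rfl
  have hpi : (Real.pi : ℂ) ≠ 0 := by exact_mod_cast Real.pi_ne_zero
  rw [hW, G_add, G_add, G_smul, h1, h3]
  push_cast
  field_simp

lemma seminorm_sum {ι : Type} (s : Finset ι) (q : ι → Seminorm ℂ 𝓢(E × E, ℂ))
    (hq : ∀ i, Continuous (q i)) (C : ι → ℝ≥0) :
    ∃ Q : Seminorm ℂ 𝓢(E × E, ℂ), Continuous Q ∧ ∀ ψ, Q ψ = ∑ i ∈ s, (C i : ℝ) * q i ψ := by
  classical
  induction s using Finset.induction_on with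
  | empty => exact ⟨0, continuous_const, fun ψ => by simp⟩
  | insert a s ha ih =>
    obtain ⟨Q, hQ, h⟩ := ih
    refine ⟨C a • q a + Q, ((hq a).const_smul (C a)).add hQ, fun ψ => ?_⟩
    rw [Finset.sum_insert ha, ← h, add_apply, smul_apply, NNReal.smul_def, smul_eq_mul]

lemma bound_zero : ∃ q : Seminorm ℂ 𝓢(E × E, ℂ), Continuous q ∧ ∀ ψ p, ‖G ψ p‖ ≤ q ψ := by
  set N := (volume : Measure E).integrablePower
  set I := ∫ y : E, (1 + ‖y‖) ^ (-((volume : Measure E).integrablePower : ℝ)) with hI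
  have hI0 : 0 ≤ I := integral_nonneg fun y => by positivity
  obtain ⟨q, hq, hqs⟩ := seminorm_sum (Finset.Iic (N, 0)) (schwartzSeminormFamily ℂ (E × E) ℂ)
    (schwartz_withSeminorms ℂ (E × E) ℂ).continuous_seminorm (fun _ => 1)
  have hsup : ∀ ψ, (Finset.Iic (N, 0)).sup (schwartzSeminormFamily ℂ (E × E) ℂ) ψ ≤ q ψ := by
    intro ψ
    rw [hqs]
    refine Seminorm.finset_sup_apply_le (Finset.sum_nonneg fun i _ => by simp) fun i hi => ?_
    simp only [NNReal.coe_one, one_mul]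
    exact Finset.single_le_sum (f := fun i => schwartzSeminormFamily ℂ (E × E) ℂ i ψ)
      (fun i _ => apply_nonneg _ _) hi
  refine ⟨(2 ^ N * I).toNNReal • q, ?_, fun ψ p => ?_⟩
  · exact hq.const_smul _
  rw [G_eq]
  have hb : ∀ y, ‖Real.fourierChar (-inner ℝ y p.2) • ψ (p.1, y)‖ ≤
      (2 ^ N * q ψ) * (1 + ‖y‖) ^ (-((volume : Measure E).integrablePower : ℝ)) := by
    intro y
    rw [Circle.norm_smul]
    have h0 := SchwartzMap.one_add_le_sup_seminorm_apply (𝕜 := ℂ) (m := (N, 0)) (k := N) (n := 0)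
      le_rfl le_rfl ψ (p.1, y)
    rw [norm_iteratedFDeriv_zero] at h0
    rw [Real.rpow_neg (by positivity), Real.rpow_natCast, ← div_eq_mul_inv,
      le_div_iff₀ (by positivity)]
    have h2 : (1 + ‖y‖) ^ N ≤ (1 + ‖(p.1, y)‖) ^ N := by
      gcongr; exact le_max_right _ _
    calc _ = (1 + ‖y‖) ^ N * ‖ψ (p.1, y)‖ := mul_comm _ _
      _ ≤ (1 + ‖(p.1, y)‖) ^ N * ‖ψ (p.1, y)‖ := by gcongr
      _ ≤ _ := h0.trans (by gcongr; exact hsup ψ)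
  have h := norm_integral_le_of_norm_le
    ((Measure.integrable_pow_neg_integrablePower volume).const_mul (2 ^ N * q ψ))
    (Eventually.of_forall hb)
  rw [integral_const_mul] at h
  refine h.trans (le_of_eq ?_)
  rw [smul_apply, NNReal.smul_def, Real.coe_toNNReal _ (by positivity), smul_eq_mul]
  ring

lemma bound_pow (k : ℕ) :
    ∃ q : Seminorm ℂ 𝓢(E × E, ℂ), Continuous q ∧ ∀ ψ p, ‖p‖ ^ k * ‖G ψ p‖ ≤ q ψ := by
  induction k with
  | zero => simpa using bound_zero (E := E)
  | succ k ih =>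
    obtain ⟨q, hq, h⟩ := ih
    refine ⟨q.comp W.toLinearMap, hq.comp W.continuous, fun ψ p => ?_⟩
    refine le_trans ?_ (h (W ψ) p)
    have hn : ‖(1 + ‖p.1‖ ^ 2 + ‖p.2‖ ^ 2 : ℂ)‖ = 1 + ‖p.1‖ ^ 2 + ‖p.2‖ ^ 2 := by
      have : (1 + ‖p.1‖ ^ 2 + ‖p.2‖ ^ 2 : ℂ) = ((1 + ‖p.1‖ ^ 2 + ‖p.2‖ ^ 2 : ℝ) : ℂ) := by push_cast; rfl
      rw [this, Complex.norm_real, Real.norm_of_nonneg (by positivity)]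
    have hp : ‖p‖ ≤ 1 + ‖p.1‖ ^ 2 + ‖p.2‖ ^ 2 := by
      rw [Prod.norm_def]
      refine max_le ?_ ?_ <;> nlinarith [sq_nonneg (‖p.1‖ - 1), sq_nonneg (‖p.2‖ - 1)]
    rw [G_W, norm_mul, hn, pow_succ, mul_assoc]
    gcongr

lemma iter_aux {P ι : Type} [NormedAddCommGroup P] [NormedSpace ℝ P] [Fintype ι]
    (L : ι → ℂ →L[ℝ] (P →L[ℝ] ℂ)) : ∃ C : ι → ℝ≥0, ∀ (n : ℕ) (f : P → ℂ) (g : ι → P → ℂ),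
      (∀ i, ContDiff ℝ n (g i)) → (fderiv ℝ f = fun p => ∑ i, L i (g i p)) → ∀ p,
      ‖iteratedFDeriv ℝ (n + 1) f p‖ ≤ ∑ i, C i * ‖iteratedFDeriv ℝ n (g i) p‖ := by
  refine ⟨fun i => ‖L i‖₊, fun n f g hg hf p => ?_⟩
  have hc : ∀ i, ContDiff ℝ n (fun p => L i (g i p)) := fun i => (L i).contDiff.comp (hg i)
  rw [← norm_iteratedFDeriv_fderiv, hf, iteratedFDeriv_fun_sum_apply fun i _ => (hc i).contDiffAt]
  refine (norm_sum_le _ _).trans (Finset.sum_le_sum fun i _ => ?_)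
  exact (L i).norm_iteratedFDeriv_comp_left (hg i).contDiffAt le_rfl

lemma bound_iter (k n : ℕ) : ∃ q : Seminorm ℂ 𝓢(E × E, ℂ), Continuous q ∧
    ∀ ψ p, ‖p‖ ^ k * ‖iteratedFDeriv ℝ n (G ψ) p‖ ≤ q ψ := by
  have B := Module.finBasis ℝ (E × E)
  induction n with
  | zero => simpa using bound_pow (E := E) k
  | succ n ih =>
    obtain ⟨q, hq, h⟩ := ih
    obtain ⟨C, hC⟩ := iter_aux (fun i => ContinuousLinearMap.smulRightL ℝ (E × E) ℂ
      (LinearMap.toContinuousLinearMap (B.coord i)))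
    obtain ⟨Q, hQ, hQs⟩ := seminorm_sum Finset.univ (fun i => q.comp (D (B i)).toLinearMap)
      (fun i => hq.comp (D (B i)).continuous) C
    refine ⟨Q, hQ, fun ψ p => ?_⟩
    · have h1 := hC n (G ψ) (fun i => G (D (B i) ψ)) (fun i => contDiff_G_nat n _)
        (fderiv_G_sum B ψ) p
      calc _ ≤ ‖p‖ ^ k * ∑ i, C i * ‖iteratedFDeriv ℝ n (G (D (B i) ψ)) p‖ := by gcongr
        _ = ∑ i, (C i : ℝ) * (‖p‖ ^ k * ‖iteratedFDeriv ℝ n (G (D (B i) ψ)) p‖) := by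
            rw [Finset.mul_sum]; exact Finset.sum_congr rfl fun i _ => by ring
        _ ≤ ∑ i, (C i : ℝ) * q (D (B i) ψ) := by
            gcongr with i; exact h _ _
        _ = _ := (hQs ψ).symm

/-- The Fourier transform in the second variable, `∫ e^{-2πi y·ξ} ψ(x,y) dy`, as an operator on
Schwartz functions. -/
noncomputable def GCLM : 𝓢(E × E, ℂ) →L[ℂ] 𝓢(E × E, ℂ) :=
  SchwartzMap.mkCLM (σ := RingHom.id ℂ) G G_add G_smul contDiff_G fun n => by
    obtain ⟨q, hq, h⟩ := bound_iter (E := E) n.1 n.2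
    obtain ⟨s, C, -, hs⟩ := Seminorm.bound_of_continuous (schwartz_withSeminorms ℂ (E × E) ℂ) q hq
    exact ⟨s, C, C.2, fun ψ p => (h ψ p).trans (by simpa [NNReal.smul_def] using hs ψ)⟩

lemma GCLM_apply (ψ : 𝓢(E × E, ℂ)) (p : E × E) : GCLM ψ p = G ψ p := rfl

/-- The dilation `(x, ξ) ↦ (x, -(2π)⁻¹ ξ)`. -/
noncomputable def dilate : (E × E) ≃L[ℝ] (E × E) :=
  (ContinuousLinearEquiv.refl ℝ E).prodCongr
    (ContinuousLinearEquiv.smulLeft (Units.mk0 (-(2 * Real.pi)⁻¹ : ℝ)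
      (neg_ne_zero.2 (inv_ne_zero (by positivity)))))

lemma dilate_apply (p : E × E) : dilate p = (p.1, (-(2 * Real.pi)⁻¹ : ℝ) • p.2) := rfl

/-- The shear `(x, z) ↦ (x, x - z)`. -/
noncomputable def shear : (E × E) ≃L[ℝ] (E × E) :=
  ContinuousLinearEquiv.equivOfInverse
    ((ContinuousLinearMap.fst ℝ E E).prod
      (ContinuousLinearMap.fst ℝ E E - ContinuousLinearMap.snd ℝ E E))
    ((ContinuousLinearMap.fst ℝ E E).prod
      (ContinuousLinearMap.fst ℝ E E - ContinuousLinearMap.snd ℝ E E))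
    (fun p => by ext <;> simp) (fun p => by ext <;> simp)

lemma shear_apply (p : E × E) : shear p = (p.1, p.1 - p.2) := rfl

end PartialFourier

section Definitions

variable {E : Type} [NormedAddCommGroup E] [InnerProductSpace ℝ E] [FiniteDimensional ℝ E]
  [MeasurableSpace E] [BorelSpace E]

/-- The inverse Fourier transform in the second variable, in the convention
`ℱψ(ξ) = ∫ e^{-i y·ξ} ψ(y) dy`, on Schwartz functions of two variables;
see `partialFourierInvSchwartz_apply`. -/
noncomputable def partialFourierInvSchwartz : 𝓢(E × E, ℂ) →L[ℂ] 𝓢(E × E, ℂ) :=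
  ((((2 * Real.pi) ^ Module.finrank ℝ E)⁻¹ : ℝ) : ℂ) •
    (SchwartzMap.compCLMOfContinuousLinearEquiv ℂ PartialFourier.dilate ∘L PartialFourier.GCLM)

lemma partialFourierInvSchwartz_apply (ψ : 𝓢(E × E, ℂ)) (x ζ : E) :
    partialFourierInvSchwartz ψ (x, ζ) = ((((2 * Real.pi) ^ Module.finrank ℝ E)⁻¹ : ℝ) : ℂ) *
      ∫ z, Complex.exp (Complex.I * (inner ℝ z ζ : ℝ)) * ψ (x, z) := by
  have h : partialFourierInvSchwartz ψ (x, ζ) =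
      ((((2 * Real.pi) ^ Module.finrank ℝ E)⁻¹ : ℝ) : ℂ) *
        PartialFourier.G ψ (x, (-(2 * Real.pi)⁻¹ : ℝ) • ζ) := rfl
  rw [h, PartialFourier.G_eq]
  congr 1
  refine integral_congr_ae (Eventually.of_forall fun z => ?_)
  simp only [Circle.smul_def, Real.fourierChar_apply, smul_eq_mul, inner_smul_right]
  congr 2
  have : (Real.pi : ℂ) ≠ 0 := by exact_mod_cast Real.pi_ne_zero
  push_cast
  field_simp

/-- The partial inverse Fourier transform `ℱ⁻¹_{ξ→z}` on tempered distributions, by duality. -/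
noncomputable def partialFourierInv : 𝓢'(E × E, ℂ) →L[ℂ] 𝓢'(E × E, ℂ) :=
  PointwiseConvergenceCLM.precomp ℂ partialFourierInvSchwartz

/-- The distribution kernel `K(x, y) = (ℱ⁻¹_{ξ→z} b)(x, z)|_{z = x - y}` of the pseudo-differential
operator `b(x, D)` with symbol `b ∈ 𝓢'(E × E)`: the pullback of `ℱ⁻¹_{ξ→z} b` along
`(x, y) ↦ (x, x - y)`, which is an involution of Jacobian `± 1`. -/
noncomputable def distributionKernel (b : 𝓢'(E × E, ℂ)) : 𝓢'(E × E, ℂ) :=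
  PointwiseConvergenceCLM.precomp ℂ
    (SchwartzMap.compCLMOfContinuousLinearEquiv ℂ PartialFourier.shear) (partialFourierInv b)

/-- The tempered distribution `T` is given by the locally integrable function `f`, i.e. the two
define the same distribution on compactly supported smooth functions (so that, in the usual
abuse of notation, `f = T ∈ 𝓢' ∩ L₁^loc`). -/
def IsGivenBy {X : Type} [NormedAddCommGroup X] [NormedSpace ℝ X] [MeasureSpace X]
    (T : 𝓢'(X, ℂ)) (f : X → ℂ) : Prop :=
  LocallyIntegrable f ∧ ∀ ψ : 𝓢(X, ℂ), HasCompactSupport ψ → T ψ = ∫ x, f x * ψ x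

/-- The spectrum `supp ℱv` of a tempered distribution, in the convention
`ℱv(ξ) = ∫ e^{-i x·ξ} v(x) dx`. Mathlib's transform `𝓕` has the phase `e^{-2πi x·ξ}` instead, so that
`ℱv = (𝓕 v)(· / 2π)`. -/
noncomputable def fourierSpectrum (v : 𝓢'(E, ℂ)) : Set E :=
  {ξ | (2 * Real.pi)⁻¹ • ξ ∈ dsupport (𝓕 v : 𝓢'(E, ℂ))}

/-- `Ψ ∈ C^∞(ℝ, ℝ)` with `Ψ = 1` on `]-∞, 11/10]` and `Ψ = 0` on `[13/10, ∞[`. -/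
def IsLPCutoff (Ψ : ℝ → ℝ) : Prop :=
  ContDiff ℝ ∞ Ψ ∧ (∀ s, s ≤ 11 / 10 → Ψ s = 1) ∧ ∀ s, 13 / 10 ≤ s → Ψ s = 0

/-- `Φ₁(ξ) = Ψ(|ξ|/2) - Ψ(|ξ|)`. -/
noncomputable def lpPhiOne (Ψ : ℝ → ℝ) (ξ : E) : ℝ := Ψ (‖ξ‖ / 2) - Ψ ‖ξ‖

/-- The homogeneous dyadic partition of unity `φ_j(ξ) = Φ₁(2^{1-j} ξ)`, `j ∈ ℤ`. -/
noncomputable def lpPhi (Ψ : ℝ → ℝ) (j : ℤ) (ξ : E) : ℝ := lpPhiOne Ψ ((2 : ℝ) ^ (1 - j) • ξ)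

/-- `φ_j(D) f = ℱ⁻¹(φ_j ℱf)` for an integrable function `f`, i.e.
`φ_j(D) f(x) = (2π)⁻ⁿ ∫ e^{i x·ξ} φ_j(ξ) ∫ e^{-i y·ξ} f(y) dy dξ`, written with the `2π`-normalised
transforms after the substitution `ξ ↦ 2π ξ`. -/
noncomputable def lpPiece (Ψ : ℝ → ℝ) (j : ℤ) (f : E → ℂ) : E → ℂ :=
  𝓕⁻ (fun ξ : E => (lpPhi Ψ j ((2 * Real.pi) • ξ) : ℂ) * 𝓕 f ξ)

/-- The homogeneous Besov norm `‖f‖_{Ḃ^s_{p,q}} = (∑_{j ∈ ℤ} 2^{sjq} ‖φ_j(D) f‖_p^q)^{1/q}`,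
`0 < q < ∞`, of an integrable function `f`. -/
noncomputable def homBesovNorm (Ψ : ℝ → ℝ) (s : ℝ) (p : ℝ≥0∞) (q : ℝ) (f : E → ℂ) : ℝ≥0∞ :=
  (∑' j : ℤ, ENNReal.ofReal ((2 : ℝ) ^ (s * j * q)) *
    (eLpNorm (lpPiece Ψ j f) p volume) ^ q) ^ (1 / q)

/-- The maximal function `M_t f(x) = sup_{r>0} (|B(x,r)|⁻¹ ∫_{B(x,r)} |f|^t dy)^{1/t}`. -/
noncomputable def maximalFunction (t : ℝ) (f : E → ℂ) (x : E) : ℝ≥0∞ :=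
  ⨆ (r : ℝ) (_ : 0 < r),
    ((volume (Metric.ball x r))⁻¹ * ∫⁻ y in Metric.ball x r, ‖f y‖ₑ ^ t) ^ (1 / t)

/-- The action `x ↦ ∫ K(x, y) v(y) dy` of the operator with kernel function `K` on `v`. -/
noncomputable def kernelAction (K : E × E → ℂ) (v : E → ℂ) (x : E) : ℂ := ∫ y, K (x, y) * v y

end Definitions

/-! Fix `x`, write `R = 2^k`, `a = R / 2π` and `h(ξ) = b(x, Rξ)`, a function supported in the unit
ball. Then `K(x, y) = aⁿ 𝓕h(a(y - x))` (`symbolKernel_eq_fourier`), so `K(x, ·)` and `v` both have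
spectrum in the ball of radius `a`, in the normalisation of `𝓕`, and their product is band-limited
again.

For band-limited functions the `L₁` norm is controlled by the `L_t` quasi-norm, `t ≤ 1`, at the cost
of a power of `aⁿ` (Nikolskij, `lintegral_enorm_le_of_fourier_eq_zero`; for the product,
`lintegral_fourier_mul_le_of_dsupport`). It remains to bound `∫ |𝓕h(a(y - x)) v(y)|^t dy`. At each
nonzero point at most two dyadic pieces recover `𝓕h`, and the `j`-th is bounded by `‖φ_j(D)h‖₁`.
This piece contributes at most `‖φ_j(D)h‖₁^t` times the integral of `|v|^t` over a ball about `x` of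
radius comparable to `2^j / a`, and that integral is at most the volume `c 2^{jn} a⁻ⁿ` times `M_t
v(x)^t`. As `2^{jn} = 2^{(n/t)jt}`, the sum over `j` is the Besov norm of order `n/t`
(`lintegral_fourier_mul_rpow_le`). All powers of `a` cancel, hence the independence of `k`.

Two facts about distributions make this meaningful: a distribution with compact spectrum is a
function of polynomial growth in the mean (`exists_function_of_dsupport_fourier_subset`), and the
distribution kernel is the oscillatory integral of the symbol (`isGivenBy_symbolKernel`). -/

/-! ### Supports of tempered distributions and the functions representing them. -/

section DistributionSupport

variable {X : Type} [NormedAddCommGroup X] [NormedSpace ℝ X] [FiniteDimensional ℝ X]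

lemma toSchwartzMap_apply {f : X → ℂ} (h₁ : HasCompactSupport f) (h₂ : ContDiff ℝ ∞ f) (x : X) :
    h₁.toSchwartzMap h₂ x = f x := rfl

open scoped Manifold in
/-- A distribution vanishes on compactly supported test functions supported off its support. -/
lemma apply_eq_zero_of_disjoint_dsupport_of_hasCompactSupport (V : 𝓢'(X, ℂ)) (ψ : 𝓢(X, ℂ))
    (hψ : HasCompactSupport ψ) (h : tsupport ψ ⊆ (dsupport V)ᶜ) : V ψ = 0 := by
  have hU : ∀ x ∈ tsupport ψ, ∃ U : Set X, IsVanishingOn V U ∧ IsOpen U ∧ x ∈ U := fun x hx =>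
    (notMem_dsupport_iff x).1 (h hx)
  choose! U hU1 hU2 hU3 using hU
  obtain ⟨s, hs, hsc⟩ := hψ.elim_nhds_subcover U fun x hx => (hU2 x hx).mem_nhds (hU3 x hx)
  -- Vanishing is local: a finite partition of unity on the compact support splits `ψ` into test
  -- functions, each living in one open set where `V` vanishes.
  obtain ⟨f, hf⟩ := SmoothPartitionOfUnity.exists_isSubordinate 𝓘(ℝ, X) (isClosed_tsupport ψ)
    (fun i : s => U i) (fun i => hU2 i (hs i i.2)) (by simpa [iUnion_subtype] using hsc)
  let g : s → 𝓢(X, ℂ) := fun i =>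
    (hψ.smul_left (f := fun x => f i x)).toSchwartzMap
      ((f i).contMDiff.contDiff.smul (ψ.smooth ⊤))
  have hg : ψ = ∑ i, g i := by
    ext x
    rw [sum_apply]
    simp only [g, toSchwartzMap_apply, Pi.smul_apply', ← Finset.sum_smul]
    by_cases hx : x ∈ tsupport ψ
    · have := f.sum_eq_one hx
      rw [finsum_eq_sum_of_fintype] at this
      rw [this, one_smul]
    · rw [image_eq_zero_of_notMem_tsupport hx, smul_zero]
  rw [hg, map_sum]
  exact Finset.sum_eq_zero fun i _ => hU1 i (hs i i.2) _
    ((tsupport_smul_subset_left _ _).trans (hf i))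

/-- The bound is uniform in `r ≤ 1` because each derivative of a dilate only gains a factor `r`.
Derivatives of positive order do not see the constant `1` and so have compact support. -/
lemma ContDiffBump.exists_bound_iteratedFDeriv_dilate_sub_one (χ : ContDiffBump (0 : X)) (i : ℕ) :
    ∃ C : ℝ, 0 ≤ C ∧ ∀ r : ℝ, 0 < r → r ≤ 1 → ∀ x,
      ‖iteratedFDeriv ℝ i (fun x : X => χ (r • x) - 1) x‖ ≤ C := by
  have hχ1 : ContDiff ℝ ∞ fun x : X => χ x - 1 := χ.contDiff.sub contDiff_const
  have hb : ∃ C, ∀ x, ‖iteratedFDeriv ℝ i (fun x : X => χ x - 1) x‖ ≤ C := by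
    rcases i with _ | i
    · refine ⟨1, fun x => ?_⟩
      rw [norm_iteratedFDeriv_zero, Real.norm_eq_abs, abs_le]
      constructor <;> linarith [χ.nonneg (x := x), χ.le_one (x := x)]
    · have hcs : HasCompactSupport (iteratedFDeriv ℝ (i + 1) (fun x : X => χ x - 1)) := by
        have h1 : fderiv ℝ (fun x : X => χ x - 1) = fderiv ℝ (χ : X → ℝ) :=
          funext fun x => fderiv_sub_const 1
        have : iteratedFDeriv ℝ (i + 1) (fun x : X => χ x - 1) =
            iteratedFDeriv ℝ (i + 1) (χ : X → ℝ) := by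
          ext1 x
          rw [iteratedFDeriv_succ_eq_comp_right, iteratedFDeriv_succ_eq_comp_right, h1]
        rw [this]
        exact χ.hasCompactSupport.iteratedFDeriv (i + 1)
      exact hcs.exists_bound_of_continuous
        (hχ1.continuous_iteratedFDeriv (by exact_mod_cast le_top))
  obtain ⟨C, hC⟩ := hb
  refine ⟨C, (norm_nonneg _).trans (hC 0), fun r hr0 hr1 x => ?_⟩
  have := iteratedFDeriv_comp_const_smul (𝕜 := ℝ) (i := i) r
    (hχ1.of_le (by exact_mod_cast le_top) : ContDiff ℝ i fun x : X => χ x - 1)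
  rw [this]
  simp only [norm_smul, norm_pow, Real.norm_eq_abs, abs_of_pos hr0]
  calc _ ≤ 1 * C := mul_le_mul (pow_le_one₀ hr0.le hr1) (hC _) (norm_nonneg _) zero_le_one
    _ = C := one_mul C

/-- The factor `χ(r·) - 1` vanishes where `r‖x‖ < 1`; elsewhere `1 ≤ r‖x‖`, so one more power of
`‖x‖` in the seminorm buys the factor `r`. This is the rate at which truncations converge. -/
lemma pow_mul_norm_iteratedFDeriv_dilate_sub_one_smul_le (χ : ContDiffBump (0 : X))
    (hχ : χ.rIn = 1) (ψ : 𝓢(X, ℂ)) (k n : ℕ) : ∃ A : ℝ, 0 ≤ A ∧ ∀ r : ℝ, 0 < r → r ≤ 1 → ∀ x,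
      ‖x‖ ^ k * ‖iteratedFDeriv ℝ n (fun x => (χ (r • x) - 1) • ψ x) x‖ ≤ r * A := by
  choose C hC0 hC using χ.exists_bound_iteratedFDeriv_dilate_sub_one
  set A := ∑ i ∈ Finset.range (n + 1), (n.choose i : ℝ) * C i *
    SchwartzMap.seminorm ℝ (k + 1) (n - i) ψ with hA
  have hA0 : 0 ≤ A := Finset.sum_nonneg fun i _ =>
    mul_nonneg (mul_nonneg (Nat.cast_nonneg _) (hC0 i)) (apply_nonneg _ _)
  refine ⟨A, hA0, fun r hr0 hr1 x => ?_⟩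
  by_cases hx : ‖r • x‖ < 1
  · have : (fun x => (χ (r • x) - 1) • ψ x) =ᶠ[𝓝 x] fun _ => (0 : ℂ) := by
      have ho : ∀ᶠ y in 𝓝 x, ‖r • y‖ < 1 :=
        (continuous_const_smul r).norm.continuousAt.eventually_lt_const hx
      filter_upwards [ho] with y hy
      rw [χ.one_of_mem_closedBall (by rw [hχ]; simpa using hy.le), sub_self, zero_smul]
    rw [(Filter.EventuallyEq.iteratedFDeriv ℝ this n).eq_of_nhds, iteratedFDeriv_fun_zero]
    simpa using mul_nonneg hr0.le hA0
  · have hx' : 1 ≤ r * ‖x‖ := by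
      rw [norm_smul, Real.norm_of_nonneg hr0.le] at hx
      linarith
    have hrs : ContDiff ℝ ∞ fun x : X => χ (r • x) - 1 :=
      (χ.contDiff.comp (contDiff_const_smul r)).sub contDiff_const
    have h1 := norm_iteratedFDeriv_smul_le (𝕜 := ℝ) hrs
      (ψ.smooth ⊤) x (n := n) (by exact_mod_cast le_top)
    calc _ ≤ ‖x‖ ^ k * ∑ i ∈ Finset.range (n + 1), (n.choose i : ℝ) *
          ‖iteratedFDeriv ℝ i (fun x : X => χ (r • x) - 1) x‖ *
            ‖iteratedFDeriv ℝ (n - i) ψ x‖ := mul_le_mul_of_nonneg_left h1 (by positivity)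
      _ ≤ (r * ‖x‖) * (‖x‖ ^ k * ∑ i ∈ Finset.range (n + 1), (n.choose i : ℝ) *
          ‖iteratedFDeriv ℝ i (fun x : X => χ (r • x) - 1) x‖ *
            ‖iteratedFDeriv ℝ (n - i) ψ x‖) := le_mul_of_one_le_left
              (mul_nonneg (by positivity) (Finset.sum_nonneg fun i _ => by positivity)) hx'
      _ = r * ∑ i ∈ Finset.range (n + 1), (n.choose i : ℝ) *
          ‖iteratedFDeriv ℝ i (fun x : X => χ (r • x) - 1) x‖ *
            (‖x‖ ^ (k + 1) * ‖iteratedFDeriv ℝ (n - i) ψ x‖) := by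
          simp only [Finset.mul_sum]
          refine Finset.sum_congr rfl fun i _ => by ring
      _ ≤ r * A := by
          refine mul_le_mul_of_nonneg_left (Finset.sum_le_sum fun i _ => ?_) hr0.le
          exact mul_le_mul (mul_le_mul_of_nonneg_left (hC i r hr0 hr1 x) (Nat.cast_nonneg _))
            (SchwartzMap.le_seminorm ℝ _ _ ψ x) (by positivity)
            (mul_nonneg (Nat.cast_nonneg _) (hC0 i))

/-- The truncations of a Schwartz function converge to it. -/
lemma exists_truncation_tendsto (ψ : 𝓢(X, ℂ)) :
    ∃ g : ℕ → 𝓢(X, ℂ), (∀ m, HasCompactSupport (g m)) ∧ (∀ m, tsupport (g m) ⊆ tsupport ψ) ∧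
      Tendsto g atTop (𝓝 ψ) := by
  obtain ⟨χ, hχ⟩ : ∃ χ : ContDiffBump (0 : X), χ.rIn = 1 := ⟨⟨1, 2, one_pos, one_lt_two⟩, rfl⟩
  have hr0 : ∀ m : ℕ, 0 < ((m : ℝ) + 1)⁻¹ := fun m => by positivity
  have hr1 : ∀ m : ℕ, ((m : ℝ) + 1)⁻¹ ≤ 1 := fun m => inv_le_one_of_one_le₀ (by simp)
  have hs : ∀ m : ℕ, ContDiff ℝ ∞ fun x : X => χ (((m : ℝ) + 1)⁻¹ • x) • ψ x := fun m =>
    (χ.contDiff.comp (contDiff_const_smul _)).smul (ψ.smooth ⊤)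
  have hc : ∀ m : ℕ, HasCompactSupport fun x : X => χ (((m : ℝ) + 1)⁻¹ • x) • ψ x := fun m =>
    (χ.hasCompactSupport.comp_homeomorph (Homeomorph.smulOfNeZero _ (hr0 m).ne')).smul_right
      (f' := ψ)
  refine ⟨fun m => (hc m).toSchwartzMap (hs m), hc, fun m =>
    tsupport_smul_subset_right (fun x : X => χ (((m : ℝ) + 1)⁻¹ • x)) ψ, ?_⟩
  rw [(schwartz_withSeminorms ℝ X ℂ).tendsto_nhds]
  rintro ⟨k, n⟩ ε hε
  obtain ⟨A, hA0, hA⟩ := pow_mul_norm_iteratedFDeriv_dilate_sub_one_smul_le χ hχ ψ k n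
  have hlim : Tendsto (fun m : ℕ => ((m : ℝ) + 1)⁻¹ * A) atTop (𝓝 0) := by
    have := (tendsto_one_div_add_atTop_nhds_zero_nat (𝕜 := ℝ)).mul_const A
    simpa using this
  filter_upwards [hlim.eventually_lt_const hε] with m hm
  refine lt_of_le_of_lt (SchwartzMap.seminorm_le_bound ℝ k n _ (mul_nonneg (hr0 m).le hA0)
    fun x => ?_) hm
  have e : (⇑((hc m).toSchwartzMap (hs m) - ψ) : X → ℂ) =
      fun x => (χ (((m : ℝ) + 1)⁻¹ • x) - 1) • ψ x := by
    ext x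
    rw [sub_apply, sub_smul, one_smul, toSchwartzMap_apply]
  rw [e]
  exact hA _ (hr0 m) (hr1 m) x

/-- A distribution vanishes on test functions supported off its support. -/
lemma apply_eq_zero_of_disjoint_dsupport (V : 𝓢'(X, ℂ)) (ψ : 𝓢(X, ℂ))
    (h : tsupport ψ ⊆ (dsupport V)ᶜ) : V ψ = 0 := by
  obtain ⟨g, hg1, hg2, hg3⟩ := exists_truncation_tendsto ψ
  have h1 : Tendsto (fun m => V (g m)) atTop (𝓝 (V ψ)) := (V.continuous.tendsto ψ).comp hg3
  refine tendsto_nhds_unique h1 (tendsto_const_nhds.congr fun m => ?_)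
  exact (apply_eq_zero_of_disjoint_dsupport_of_hasCompactSupport V _ (hg1 m) ((hg2 m).trans h)).symm

/-- A factor which is one near the support of a distribution can be inserted. -/
lemma apply_smulLeftCLM_eq_of_eq_one (V : 𝓢'(X, ℂ)) (χ : X → ℂ) (hχ : χ.HasTemperateGrowth)
    {U : Set X} (hU : IsOpen U) (hV : dsupport V ⊆ U) (h1 : ∀ x ∈ U, χ x = 1) (ψ : 𝓢(X, ℂ)) :
    V (SchwartzMap.smulLeftCLM ℂ χ ψ) = V ψ := by
  rw [← sub_eq_zero, ← map_sub]
  refine apply_eq_zero_of_disjoint_dsupport V _ ?_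
  have : tsupport (⇑(SchwartzMap.smulLeftCLM ℂ χ ψ - ψ)) ⊆ Uᶜ := by
    refine closure_minimal (fun x hx hxU => hx ?_) hU.isClosed_compl
    rw [sub_apply, SchwartzMap.smulLeftCLM_apply_apply hχ, h1 x hxU, one_smul, sub_self]
  exact this.trans (compl_subset_compl.2 hV)

variable [MeasureSpace X] [BorelSpace X]

/-- Allows an arbitrary function representing the kernel or `v` to be exchanged for an explicit one.
-/
lemma isGivenBy_ae_eq {T : 𝓢'(X, ℂ)} {f g : X → ℂ} (hf : IsGivenBy T f) (hg : IsGivenBy T g) :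
    f =ᵐ[volume] g := by
  refine ae_eq_of_integral_contDiff_smul_eq hf.1 hg.1 fun u hu hc => ?_
  have hc' : HasCompactSupport (fun x => (u x : ℂ)) := hc.comp_left (g := Complex.ofReal) rfl
  have h1 := hf.2 (hc'.toSchwartzMap (Complex.ofRealCLM.contDiff.comp hu)) hc'
  rw [hg.2 (hc'.toSchwartzMap (Complex.ofRealCLM.contDiff.comp hu)) hc'] at h1
  change ∫ x, g x * (u x : ℂ) = ∫ x, f x * (u x : ℂ) at h1
  simpa [Complex.real_smul, mul_comm] using h1.symm

/-- Off its support, the function giving a distribution vanishes almost everywhere. -/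
lemma ae_eq_zero_of_isGivenBy {T : 𝓢'(X, ℂ)} {f : X → ℂ} (hf : IsGivenBy T f) {S : Set X}
    (hS : IsClosed S) (hT : dsupport T ⊆ S) : ∀ᵐ x, x ∉ S → f x = 0 := by
  refine hS.isOpen_compl.ae_eq_zero_of_integral_contDiff_smul_eq_zero
    (hf.1.locallyIntegrableOn _) fun u hu hc hs => ?_
  have hc' : HasCompactSupport (fun x => (u x : ℂ)) := hc.comp_left (g := Complex.ofReal) rfl
  have h1 := hf.2 (hc'.toSchwartzMap (Complex.ofRealCLM.contDiff.comp hu)) hc'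
  rw [apply_eq_zero_of_disjoint_dsupport] at h1
  · change _ = ∫ x, f x * (u x : ℂ) at h1
    simpa [Complex.real_smul, mul_comm] using h1.symm
  · refine (Subset.trans ?_ hs).trans (compl_subset_compl.2 hT)
    exact tsupport_comp_subset (g := Complex.ofReal) rfl _

end DistributionSupport

/-! ### Distributions with compact spectrum are functions. -/

section BandLimited

variable {E : Type} [NormedAddCommGroup E] [InnerProductSpace ℝ E] [FiniteDimensional ℝ E]
  [MeasurableSpace E] [BorelSpace E]

/-- Multiplication of a Schwartz function by `(1 + |x|²)^r`. -/
noncomputable def japaneseMul (r : ℝ) : 𝓢(E, ℂ) →L[ℂ] 𝓢(E, ℂ) :=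
  SchwartzMap.smulLeftCLM ℂ (fun x : E => (((1 + ‖x‖ ^ 2) ^ r : ℝ) : ℂ))

lemma japaneseMul_apply (r : ℝ) (ψ : 𝓢(E, ℂ)) (x : E) :
    japaneseMul r ψ x = (((1 + ‖x‖ ^ 2) ^ r : ℝ) : ℂ) * ψ x :=
  SchwartzMap.smulLeftCLM_apply_apply
    (Complex.ofRealCLM.hasTemperateGrowth.comp (Function.hasTemperateGrowth_one_add_norm_sq_rpow E r)) _ _

lemma norm_japaneseMul_apply (r : ℝ) (ψ : 𝓢(E, ℂ)) (x : E) :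
    ‖japaneseMul r ψ x‖ = (1 + ‖x‖ ^ 2) ^ r * ‖ψ x‖ := by
  rw [japaneseMul_apply, norm_mul, Complex.norm_real, Real.norm_of_nonneg (by positivity)]

lemma japaneseMul_japaneseMul (r s : ℝ) (ψ : 𝓢(E, ℂ)) :
    japaneseMul r (japaneseMul s ψ) = japaneseMul (r + s) ψ := by
  ext x
  rw [japaneseMul_apply, japaneseMul_apply, japaneseMul_apply, Real.rpow_add (by positivity)]
  push_cast
  ring

lemma japaneseMul_zero (ψ : 𝓢(E, ℂ)) : japaneseMul 0 ψ = ψ := by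
  ext x
  simp [japaneseMul_apply]

lemma integral_norm_japaneseMul_mono {r s : ℝ} (h : r ≤ s) (ψ : 𝓢(E, ℂ)) :
    ∫ x, ‖japaneseMul r ψ x‖ ≤ ∫ x, ‖japaneseMul s ψ x‖ := by
  refine integral_mono (japaneseMul r ψ).integrable.norm (japaneseMul s ψ).integrable.norm fun x => ?_
  simp only [norm_japaneseMul_apply]
  gcongr
  nlinarith [sq_nonneg ‖x‖]

/-- Derivatives of the inverse transform are bounded by moments of `ψ`, and each of the `i + 1`
moments of order at most `i` is dominated by the weight `(1 + |y|²)^i`. -/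
lemma norm_iteratedFDeriv_fourierInv_le (i : ℕ) : ∃ C : ℝ, 0 ≤ C ∧ ∀ (ψ : 𝓢(E, ℂ)) (x : E),
    ‖iteratedFDeriv ℝ i (𝓕⁻ ψ : 𝓢(E, ℂ)) x‖ ≤ C * ∫ y, ‖japaneseMul i ψ y‖ := by
  refine ⟨(2 * Real.pi) ^ i * (i + 1), by positivity, fun ψ x => ?_⟩
  have h1 := Real.pow_mul_norm_iteratedFDeriv_fourier_le (K := ⊤) (N := ⊤) (ψ.smooth ⊤)
    (fun k n _ _ => ψ.integrable_pow_mul_iteratedFDeriv volume k n) (k := i) (n := 0) le_top le_top (-x)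
  have h2 : (⇑(𝓕⁻ ψ : 𝓢(E, ℂ)) : E → ℂ) = 𝓕 (ψ : E → ℂ) ∘ (LinearIsometryEquiv.neg ℝ : E ≃ₗᵢ[ℝ] E) := by
    ext y
    rw [SchwartzMap.fourierInv_coe, Real.fourierInv_eq_fourier_neg]
    rfl
  have h3 : ‖iteratedFDeriv ℝ i (𝓕⁻ ψ : 𝓢(E, ℂ)) x‖ = ‖iteratedFDeriv ℝ i (𝓕 (ψ : E → ℂ)) (-x)‖ := by
    rw [h2, LinearIsometryEquiv.norm_iteratedFDeriv_comp_right]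
    rfl
  rw [h3]
  simp only [pow_zero, one_mul, mul_one, zero_add, Finset.range_one, Finset.sum_product,
    Finset.sum_singleton, norm_iteratedFDeriv_zero] at h1
  refine h1.trans ?_
  rw [mul_assoc]
  refine mul_le_mul_of_nonneg_left ?_ (by positivity)
  have h4 : ∀ p ∈ Finset.range (i + 1), ∫ v, ‖v‖ ^ p * ‖ψ v‖ ≤ ∫ y, ‖japaneseMul i ψ y‖ := by
    intro p hp
    refine integral_mono (ψ.integrable_pow_mul volume p) (japaneseMul i ψ).integrable.norm fun v => ?_
    simp only [norm_japaneseMul_apply, Real.rpow_natCast]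
    gcongr
    have h5 : ‖v‖ ≤ 1 + ‖v‖ ^ 2 := by nlinarith [sq_nonneg (‖v‖ - 1)]
    calc ‖v‖ ^ p ≤ (1 + ‖v‖ ^ 2) ^ p := by gcongr
      _ ≤ (1 + ‖v‖ ^ 2) ^ i := by
        gcongr
        · nlinarith [sq_nonneg ‖v‖]
        · simpa [Nat.lt_succ_iff] using hp
  calc _ ≤ ∑ p ∈ Finset.range (i + 1), ∫ y, ‖japaneseMul i ψ y‖ := Finset.sum_le_sum h4
    _ = _ := by simp

/-- By the Leibniz rule, with the powers of `‖x‖` absorbed by the compactly supported `χ`. A single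
weighted `L₁` norm of `ψ` thus controls each seminorm. -/
lemma seminorm_smulLeftCLM_fourierInv_le (χ : E → ℂ) (hχ : ContDiff ℝ ∞ χ)
    (hc : HasCompactSupport χ) (k n : ℕ) : ∃ C : ℝ, 0 ≤ C ∧ ∀ ψ : 𝓢(E, ℂ),
      SchwartzMap.seminorm ℂ k n (SchwartzMap.smulLeftCLM ℂ χ (𝓕⁻ ψ)) ≤
        C * ∫ y, ‖japaneseMul n ψ y‖ := by
  choose A hA0 hA using norm_iteratedFDeriv_fourierInv_le (E := E)
  let χ' : 𝓢(E, ℂ) := hc.toSchwartzMap hχ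
  have hB := fun i x => SchwartzMap.le_seminorm ℝ k i χ' x
  refine ⟨∑ i ∈ Finset.range (n + 1), (n.choose i : ℝ) * SchwartzMap.seminorm ℝ k i χ' * A (n - i),
    Finset.sum_nonneg fun i _ => mul_nonneg (mul_nonneg (Nat.cast_nonneg _) (apply_nonneg _ _)) (hA0 _),
    fun ψ => ?_⟩
  have hI : 0 ≤ ∫ y, ‖japaneseMul n ψ y‖ := integral_nonneg fun y => norm_nonneg _
  refine SchwartzMap.seminorm_le_bound ℂ k n _ (mul_nonneg (Finset.sum_nonneg fun i _ =>
    mul_nonneg (mul_nonneg (Nat.cast_nonneg _) (apply_nonneg _ _)) (hA0 _)) hI) fun x => ?_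
  rw [SchwartzMap.smulLeftCLM_apply (hc.hasTemperateGrowth hχ)]
  have h1 := norm_iteratedFDeriv_smul_le (𝕜 := ℝ) hχ ((𝓕⁻ ψ : 𝓢(E, ℂ)).smooth ⊤) x (n := n)
    (by exact_mod_cast le_top)
  calc _ ≤ ‖x‖ ^ k * ∑ i ∈ Finset.range (n + 1), (n.choose i : ℝ) * ‖iteratedFDeriv ℝ i χ x‖ *
        ‖iteratedFDeriv ℝ (n - i) (𝓕⁻ ψ : 𝓢(E, ℂ)) x‖ :=
      mul_le_mul_of_nonneg_left h1 (by positivity)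
    _ = ∑ i ∈ Finset.range (n + 1), (n.choose i : ℝ) * (‖x‖ ^ k * ‖iteratedFDeriv ℝ i χ' x‖) *
        ‖iteratedFDeriv ℝ (n - i) (𝓕⁻ ψ : 𝓢(E, ℂ)) x‖ := by
      rw [Finset.mul_sum]
      refine Finset.sum_congr rfl fun i _ => ?_
      change _ = (n.choose i : ℝ) * (‖x‖ ^ k * ‖iteratedFDeriv ℝ i χ x‖) * _
      ring
    _ ≤ ∑ i ∈ Finset.range (n + 1), (n.choose i : ℝ) * SchwartzMap.seminorm ℝ k i χ' *
        (A (n - i) * ∫ y, ‖japaneseMul n ψ y‖) := by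
      refine Finset.sum_le_sum fun i _ => mul_le_mul (mul_le_mul_of_nonneg_left (hB i x)
        (Nat.cast_nonneg _)) ((hA _ ψ x).trans ?_) (norm_nonneg _)
        (mul_nonneg (Nat.cast_nonneg _) (apply_nonneg _ _))
      refine mul_le_mul_of_nonneg_left (integral_norm_japaneseMul_mono ?_ ψ) (hA0 _)
      exact_mod_cast Nat.sub_le n i
    _ = _ := by
      rw [Finset.sum_mul]
      refine Finset.sum_congr rfl fun i _ => by ring

/-- The ball where `χ = 1` is open and larger than the closed ball of radius `ρ`, as
`apply_smulLeftCLM_eq_of_eq_one` requires; the absolute value keeps the radii positive for every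
`ρ`. -/
lemma exists_contDiff_cutoff (ρ : ℝ) : ∃ χ : E → ℂ, ContDiff ℝ ∞ χ ∧ HasCompactSupport χ ∧
    ∀ x ∈ Metric.ball (0 : E) (|ρ| + 1), χ x = 1 := by
  let f : ContDiffBump (0 : E) := ⟨|ρ| + 1, |ρ| + 2, by positivity, by linarith⟩
  refine ⟨fun x => (f x : ℂ), Complex.ofRealCLM.contDiff.comp f.contDiff,
    f.hasCompactSupport.comp_left (g := Complex.ofReal) rfl, fun x hx => ?_⟩
  beta_reduce
  rw [f.one_of_mem_closedBall (Metric.ball_subset_closedBall hx), Complex.ofReal_one]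

lemma closedBall_subset_ball_abs_add_one (ρ : ℝ) :
    Metric.closedBall (0 : E) ρ ⊆ Metric.ball 0 (|ρ| + 1) :=
  Metric.closedBall_subset_ball (by linarith [le_abs_self ρ])

/-- Here `V ψ = 𝓕V(χ 𝓕⁻ψ)`, and continuity bounds `𝓕V` by finitely many seminorms, each controlled
by a weighted `L₁` norm of `ψ`. -/
lemma norm_apply_le_integral_of_dsupport_fourier_subset (V : 𝓢'(E, ℂ)) {ρ : ℝ}
    (hV : dsupport (𝓕 V : 𝓢'(E, ℂ)) ⊆ Metric.closedBall 0 ρ) :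
    ∃ C N : ℝ, 0 ≤ C ∧ ∀ ψ : 𝓢(E, ℂ), ‖V ψ‖ ≤ C * ∫ y, ‖japaneseMul N ψ y‖ := by
  obtain ⟨χ, hχ, hc, h1⟩ := exists_contDiff_cutoff (E := E) ρ
  obtain ⟨s, D, -, hs⟩ := Seminorm.bound_of_continuous (schwartz_withSeminorms ℂ E ℂ)
    ((normSeminorm ℂ ℂ).comp (𝓕 V : 𝓢'(E, ℂ)).toLinearMap)
    (continuous_norm.comp (𝓕 V : 𝓢'(E, ℂ)).continuous)
  choose A hA0 hA using fun m : ℕ × ℕ => seminorm_smulLeftCLM_fourierInv_le χ hχ hc m.1 m.2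
  -- Sums replace maxima over `s`: they dominate every single constant and order.
  refine ⟨D * ∑ m ∈ s, A m, ((∑ m ∈ s, m.2 : ℕ) : ℝ),
    mul_nonneg D.2 (Finset.sum_nonneg fun i _ => hA0 i), fun ψ => ?_⟩
  have h2 : V ψ = (𝓕 V : 𝓢'(E, ℂ)) (SchwartzMap.smulLeftCLM ℂ χ (𝓕⁻ ψ)) := by
    rw [apply_smulLeftCLM_eq_of_eq_one _ χ (hc.hasTemperateGrowth hχ) Metric.isOpen_ball
      (hV.trans (closedBall_subset_ball_abs_add_one ρ)) h1, TemperedDistribution.fourier_apply,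
      FourierTransform.fourier_fourierInv_eq]
  have hI : ∀ N, 0 ≤ ∫ y, ‖japaneseMul N ψ y‖ := fun N => integral_nonneg fun y => norm_nonneg _
  rw [h2, mul_assoc]
  refine (hs _).trans ?_
  rw [smul_apply, NNReal.smul_def, smul_eq_mul]
  refine mul_le_mul_of_nonneg_left ?_ D.2
  refine Seminorm.finset_sup_apply_le (mul_nonneg (Finset.sum_nonneg fun i _ => hA0 i) (hI _))
    fun m hm => (hA m ψ).trans ?_
  refine mul_le_mul (Finset.single_le_sum (fun i _ => hA0 i) hm)
    (integral_norm_japaneseMul_mono ?_ ψ) (hI _) (Finset.sum_nonneg fun i _ => hA0 i)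
  exact_mod_cast Finset.single_le_sum (f := fun m : ℕ × ℕ => m.2) (fun i _ => Nat.zero_le _) hm

/-- Cauchy-Schwarz against the weight `(1 + |x|²)^{-L}`, which is square integrable for `L = n + 1`.
-/
lemma integral_norm_le_norm_toLp_two : ∃ C L : ℝ, 0 ≤ C ∧ ∀ φ : 𝓢(E, ℂ),
    ∫ y, ‖φ y‖ ≤ C * ‖(japaneseMul L φ).toLp 2‖ := by
  set L : ℝ := Module.finrank ℝ E + 1 with hL
  have hL0 : 0 < L := by positivity
  have hint : MemLp (fun x : E => (1 + ‖x‖ ^ 2) ^ (-L)) 2 := by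
    rw [memLp_two_iff_integrable_sq]
    · have := integrable_rpow_neg_one_add_norm_sq (E := E) (μ := volume) (r := 4 * L) (by linarith)
      refine this.congr (Eventually.of_forall fun x => ?_)
      beta_reduce
      rw [← Real.rpow_natCast ((1 + ‖x‖ ^ 2) ^ (-L)) 2, ← Real.rpow_mul (by positivity)]
      congr 1
      push_cast
      ring
    · refine Continuous.aestronglyMeasurable ?_
      exact Continuous.rpow_const (by fun_prop) fun x => Or.inl (by positivity)
  refine ⟨(∫ x : E, ((1 + ‖x‖ ^ 2) ^ (-L)) ^ (2 : ℝ)) ^ (1 / (2 : ℝ)), L, by positivity, fun φ => ?_⟩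
  have h := integral_mul_le_Lp_mul_Lq_of_nonneg (μ := (volume : Measure E)) (p := 2) (q := 2)
    ⟨by norm_num, by norm_num, by norm_num⟩
    (f := fun x : E => (1 + ‖x‖ ^ 2) ^ (-L)) (g := fun x => ‖japaneseMul L φ x‖)
    (Eventually.of_forall fun x => by positivity) (Eventually.of_forall fun x => by positivity)
    (by simpa using hint) (by simpa using ((japaneseMul L φ).memLp 2).norm)
  rw [SchwartzMap.norm_toLp' (by simp) (by simp)]
  refine (le_of_eq ?_).trans (h.trans (le_of_eq ?_))
  · refine integral_congr_ae (Eventually.of_forall fun x => ?_)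
    simp only [norm_japaneseMul_apply, ← mul_assoc]
    rw [← Real.rpow_add (by positivity)]
    simp
  · simp

lemma L2_inner_congr (g f : Lp ℂ 2 (volume : Measure E)) (φ : E → ℂ) (h : f =ᵐ[volume] φ) :
    Integrable (fun x => inner ℂ (g x) (φ x)) ∧ inner ℂ g f = ∫ x, inner ℂ (g x) (φ x) := by
  have h2 : (fun x => inner ℂ (g x) (f x)) =ᵐ[volume] fun x => inner ℂ (g x) (φ x) :=
    h.mono fun x hx => by simp only [hx]
  refine ⟨(L2.integrable_inner (𝕜 := ℂ) g f).congr h2, ?_⟩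
  rw [L2.inner_def]
  exact integral_congr_ae h2

/-- The bound lets `Λ` extend from the dense range of `e` to the whole Hilbert space, where the
Riesz theorem applies. -/
lemma exists_inner_eq_of_norm_le {S : Type} [AddCommGroup S] [Module ℂ S] (Λ : S →ₗ[ℂ] ℂ) (C : ℝ)
    (e : S →ₗ[ℂ] Lp ℂ 2 (volume : Measure E)) (he : DenseRange e) (hΛ : ∀ φ, ‖Λ φ‖ ≤ C * ‖e φ‖) :
    ∃ g : Lp ℂ 2 (volume : Measure E), ∀ φ, Λ φ = inner ℂ g (e φ) := by
  have hex : ∀ φ, Λ.extendOfNorm e (e φ) = Λ φ :=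
    fun φ => LinearMap.extendOfNorm_eq (f := Λ) (e := e) he ⟨C, hΛ⟩ φ
  obtain ⟨g, hg⟩ := (InnerProductSpace.toDual ℂ _).surjective (Λ.extendOfNorm e)
  refine ⟨g, fun φ => ?_⟩
  rw [← hex φ, ← hg, InnerProductSpace.toDual_apply_apply]

/-- Riesz representation of functionals on Schwartz functions bounded in the norm of `L²`. -/
lemma exists_L2_of_norm_le (Λ : 𝓢(E, ℂ) →ₗ[ℂ] ℂ) (C : ℝ)
    (hΛ : ∀ φ : 𝓢(E, ℂ), ‖Λ φ‖ ≤ C * ‖φ.toLp 2‖) :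
    ∃ g : Lp ℂ 2 (volume : Measure E), ∀ φ : 𝓢(E, ℂ),
      Integrable (fun x => inner ℂ (g x) (φ x)) ∧ Λ φ = ∫ x, inner ℂ (g x) (φ x) := by
  have he : DenseRange ((SchwartzMap.toLpCLM ℂ ℂ 2 (volume : Measure E)).toLinearMap :
      𝓢(E, ℂ) →ₗ[ℂ] Lp ℂ 2 (volume : Measure E)) :=
    SchwartzMap.denseRange_toLpCLM (F := ℂ) (by simp)
  obtain ⟨g, hg⟩ := exists_inner_eq_of_norm_le Λ C _ he hΛ
  refine ⟨g, fun φ => ?_⟩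
  have h := L2_inner_congr g (φ.toLp 2) φ (φ.coeFn_toLp 2)
  exact ⟨h.1, (hg φ).trans h.2⟩

/-- A distribution whose Fourier transform has compact support is a function of polynomial growth
(in the mean). -/
lemma exists_function_of_dsupport_fourier_subset (V : 𝓢'(E, ℂ)) {ρ : ℝ}
    (hV : dsupport (𝓕 V : 𝓢'(E, ℂ)) ⊆ Metric.closedBall 0 ρ) :
    ∃ v : E → ℂ, LocallyIntegrable v ∧ ∀ ψ : 𝓢(E, ℂ),
      Integrable (fun x => v x * ψ x) ∧ V ψ = ∫ x, v x * ψ x := by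
  obtain ⟨C, N, hC, hV1⟩ := norm_apply_le_integral_of_dsupport_fourier_subset V hV
  obtain ⟨D, L, hD, hL⟩ := integral_norm_le_norm_toLp_two (E := E)
  -- The weight of order `N` pays for the bound on `V`, that of order `L` for passing from `L₁` to
  -- `L₂`. So `φ ↦ V((1 + |x|²)^{-M} φ)` is `L₂`-bounded, and its Riesz representative, conjugated
  -- and multiplied by `(1 + |x|²)^M`, represents `V` against every Schwartz function.
  set M := L + N with hM
  have hreal : ∀ a I n : ℝ, a ≤ C * I → I ≤ D * n → a ≤ C * D * n := fun a I n h1 h2 =>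
    h1.trans ((mul_le_mul_of_nonneg_left h2 hC).trans_eq (mul_assoc C D n).symm)
  have hb : ∀ φ : 𝓢(E, ℂ), ‖V (japaneseMul (-M) φ)‖ ≤ C * D * ‖φ.toLp 2‖ := by
    intro φ
    have h1 := hV1 (japaneseMul (-M) φ)
    have h2 := hL (japaneseMul N (japaneseMul (-M) φ))
    rw [japaneseMul_japaneseMul L, japaneseMul_japaneseMul (L + N), ← hM, add_neg_cancel,
      japaneseMul_zero] at h2
    exact hreal _ _ _ h1 h2
  obtain ⟨g, hrep⟩ := exists_L2_of_norm_le ((V.toLinearMap).comp (japaneseMul (-M)).toLinearMap)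
    (C * D) hb
  have hw : Continuous fun x : E => (((1 + ‖x‖ ^ 2) ^ M : ℝ) : ℂ) := by
    refine Complex.continuous_ofReal.comp (Continuous.rpow_const (by fun_prop) fun x => Or.inl ?_)
    positivity
  have key : ∀ ψ : 𝓢(E, ℂ), (fun x => inner ℂ (g x) (japaneseMul M ψ x)) =
      fun x => ((((1 + ‖x‖ ^ 2) ^ M : ℝ) : ℂ) * starRingEnd ℂ (g x)) * ψ x := by
    intro ψ
    ext x
    rw [japaneseMul_apply, RCLike.inner_apply]
    ring
  refine ⟨fun x => (((1 + ‖x‖ ^ 2) ^ M : ℝ) : ℂ) * starRingEnd ℂ (g x), ?_, fun ψ => ?_⟩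
  · have h1 : LocallyIntegrable (fun x => starRingEnd ℂ (g x)) :=
      ((Lp.memLp g).star).locallyIntegrable (by norm_num)
    simpa only [smul_eq_mul] using h1.continuous_smul hw
  · obtain ⟨h1, h2⟩ := hrep (japaneseMul M ψ)
    rw [key] at h1 h2
    refine ⟨h1, ?_⟩
    rw [← h2]
    change _ = V (japaneseMul (-M) (japaneseMul M ψ))
    rw [japaneseMul_japaneseMul, neg_add_cancel, japaneseMul_zero]

end BandLimited

/-! ### Nikolskij's inequality, also for products of a kernel and a band-limited function. -/

section Nikolskij

variable {E : Type} [NormedAddCommGroup E] [InnerProductSpace ℝ E] [FiniteDimensional ℝ E]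
  [MeasurableSpace E] [BorelSpace E]

lemma continuous_fourier_of_integrable {f : E → ℂ} (hf : Integrable f) : Continuous (𝓕 f) :=
  VectorFourier.fourierIntegral_continuous Real.continuous_fourierChar (innerSL ℝ).continuous₂ hf

lemma enorm_fourier_le (f : E → ℂ) (ξ : E) : ‖𝓕 f ξ‖ₑ ≤ ∫⁻ x, ‖f x‖ₑ := by
  rw [Real.fourier_eq]
  refine (enorm_integral_le_lintegral_enorm _).trans (le_of_eq ?_)
  refine lintegral_congr fun x => ?_
  rw [← ofReal_norm, ← ofReal_norm, Circle.norm_smul]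

lemma enorm_fourierInv_le (f : E → ℂ) (x : E) : ‖𝓕⁻ f x‖ₑ ≤ ∫⁻ ξ, ‖f ξ‖ₑ := by
  rw [Real.fourierInv_eq_fourier_neg]
  exact enorm_fourier_le f _

lemma integral_fourier_mul_eq_flip {f g : E → ℂ} (hf : Integrable f) (hg : Integrable g) :
    ∫ ξ, 𝓕 f ξ * g ξ = ∫ x, f x * 𝓕 g x := by
  have h := VectorFourier.integral_fourierIntegral_smul_eq_flip (L := innerₗ E)
    Real.continuous_fourierChar (by exact continuous_inner) hf hg
  rw [flip_innerₗ] at h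
  exact h

lemma integral_fourierInv_mul_eq_flip {f g : E → ℂ} (hf : Integrable f) (hg : Integrable g) :
    ∫ ξ, 𝓕⁻ f ξ * g ξ = ∫ x, f x * 𝓕⁻ g x := by
  have h := integral_fourier_mul_eq_flip hf hg.comp_neg
  rw [Real.fourierInv_eq_fourier_comp_neg g, ← h,
    ← integral_neg_eq_self (fun ξ => 𝓕 f ξ * g (-ξ))]
  simp only [neg_neg, Real.fourierInv_eq_fourier_neg]

/-- Fourier inversion almost everywhere. -/
lemma ae_eq_fourierInv_fourier {f : E → ℂ} (hf : Integrable f) (hF : Integrable (𝓕 f)) :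
    f =ᵐ[volume] 𝓕⁻ (𝓕 f) := by
  have hc : Continuous (𝓕⁻ (𝓕 f)) := by
    have := (continuous_fourier_of_integrable hF).comp continuous_neg
    refine this.congr fun x => ?_
    rw [Real.fourierInv_eq_fourier_neg]
    rfl
  -- Since `f` need not be continuous, the identity is tested against smooth functions: both
  -- transforms are moved onto the test function, where inversion is known.
  refine ae_eq_of_integral_contDiff_smul_eq hf.locallyIntegrable hc.locallyIntegrable
    fun u hu hcu => ?_
  have hc' : HasCompactSupport (fun x => (u x : ℂ)) := hcu.comp_left (g := Complex.ofReal) rfl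
  let ψ : 𝓢(E, ℂ) := hc'.toSchwartzMap (Complex.ofRealCLM.contDiff.comp hu)
  have h1 : ∫ x, f x * ψ x = ∫ x, 𝓕 f x * 𝓕⁻ (ψ : E → ℂ) x := by
    have h := integral_fourier_mul_eq_flip hf (𝓕⁻ ψ : 𝓢(E, ℂ)).integrable
    have e : 𝓕 (⇑(𝓕⁻ ψ : 𝓢(E, ℂ)) : E → ℂ) = ψ := by
      rw [← SchwartzMap.fourier_coe, FourierTransform.fourier_fourierInv_eq]
    rw [e, SchwartzMap.fourierInv_coe] at h
    exact h.symm
  have h2 := integral_fourierInv_mul_eq_flip hF ψ.integrable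
  have h3 : ∫ x, f x * (u x : ℂ) = ∫ x, 𝓕⁻ (𝓕 f) x * (u x : ℂ) := h1.trans h2.symm
  simpa only [Complex.real_smul, mul_comm] using h3

/-- An integrable function with compactly supported Fourier transform is bounded by its norm. -/
lemma ae_enorm_le_of_fourier_eq_zero {f : E → ℂ} (hf : Integrable f) {r : ℝ}
    (hr : ∀ ξ, r < ‖ξ‖ → 𝓕 f ξ = 0) :
    ∀ᵐ x, ‖f x‖ₑ ≤ volume (Metric.closedBall (0 : E) r) * ∫⁻ y, ‖f y‖ₑ := by
  have hc := continuous_fourier_of_integrable hf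
  have hs : HasCompactSupport (𝓕 f) := HasCompactSupport.intro (isCompact_closedBall (0 : E) r)
    fun ξ hξ => hr ξ (by simpa using hξ)
  have hF : Integrable (𝓕 f) := hc.integrable_of_hasCompactSupport hs
  filter_upwards [ae_eq_fourierInv_fourier hf hF] with x hx
  rw [hx]
  refine (enorm_fourierInv_le _ x).trans ?_
  calc ∫⁻ ξ, ‖𝓕 f ξ‖ₑ ≤ ∫⁻ ξ, (Metric.closedBall (0 : E) r).indicator
        (fun _ => ∫⁻ y, ‖f y‖ₑ) ξ := by
        refine lintegral_mono fun ξ => ?_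
        by_cases h : ξ ∈ Metric.closedBall (0 : E) r
        · rw [indicator_of_mem h]
          exact enorm_fourier_le f ξ
        · rw [indicator_of_notMem h, hr ξ (by simpa using h), enorm_zero]
    _ = _ := by
        rw [lintegral_indicator_const Metric.isClosed_closedBall.measurableSet, mul_comm]

/-- The Nikolskij inequality between `L_t` and `L_1`, `0 < t ≤ 1`. -/
lemma lintegral_enorm_le_of_fourier_eq_zero {f : E → ℂ} (hf : Integrable f) {r : ℝ}
    (hr : ∀ ξ, r < ‖ξ‖ → 𝓕 f ξ = 0) {t : ℝ} (ht0 : 0 < t) (ht1 : t ≤ 1) :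
    ∫⁻ x, ‖f x‖ₑ ≤ (volume (Metric.closedBall (0 : E) r) ^ (1 - t) * ∫⁻ x, ‖f x‖ₑ ^ t) ^ (1 / t) := by
  set N := ∫⁻ x, ‖f x‖ₑ with hN
  set C := volume (Metric.closedBall (0 : E) r)
  have hNtop : N ≠ ⊤ := hf.2.ne
  by_cases hN0 : N = 0
  · rw [hN0]; exact zero_le
  -- Split `|f| = |f|^{1-t} |f|^t` and use `|f| ≤ C‖f‖₁` on the first factor. The power `N^{1-t}` is
  -- then cancelled, which needs `N` finite and nonzero.
  have h1 : N ≤ N ^ (1 - t) * (C ^ (1 - t) * ∫⁻ x, ‖f x‖ₑ ^ t) := by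
    calc N = ∫⁻ x, ‖f x‖ₑ ^ (1 - t) * ‖f x‖ₑ ^ t := by
          refine lintegral_congr fun x => ?_
          rw [← ENNReal.rpow_add_of_nonneg _ _ (by linarith) ht0.le, sub_add_cancel,
            ENNReal.rpow_one]
      _ ≤ ∫⁻ x, (C * N) ^ (1 - t) * ‖f x‖ₑ ^ t := by
          refine lintegral_mono_ae ?_
          filter_upwards [ae_enorm_le_of_fourier_eq_zero hf hr] with x hx
          gcongr
      _ = (C * N) ^ (1 - t) * ∫⁻ x, ‖f x‖ₑ ^ t :=
          lintegral_const_mul'' _ (hf.1.enorm.pow_const t)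
      _ = _ := by
          rw [ENNReal.mul_rpow_of_nonneg _ _ (by linarith)]
          ring
  have h2 : N ^ t ≤ C ^ (1 - t) * ∫⁻ x, ‖f x‖ₑ ^ t := by
    have e : N = N ^ (1 - t) * N ^ t := by
      rw [← ENNReal.rpow_add_of_nonneg _ _ (by linarith) ht0.le, sub_add_cancel, ENNReal.rpow_one]
    have hne : N ^ (1 - t) ≠ 0 := by simp [hN0, hNtop]
    have hne' : N ^ (1 - t) ≠ ⊤ := ENNReal.rpow_ne_top_of_nonneg (by linarith) hNtop
    rw [← ENNReal.mul_le_mul_iff_right hne hne', ← e]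
    exact h1
  calc N = (N ^ t) ^ (1 / t) := by
        rw [← ENNReal.rpow_mul, mul_one_div_cancel ht0.ne', ENNReal.rpow_one]
    _ ≤ _ := by gcongr

/-- The Fourier transform of a product with a dilated and translated Fourier transform. -/
lemma fourier_fourier_mul {h w : E → ℂ} (hh : Integrable h) (hw : Integrable w) (a : ℝ) (x ζ : E) :
    𝓕 (fun y => 𝓕 h (a • (y - x)) * w y) ζ =
      ∫ ξ, (Real.fourierChar (a * inner ℝ ξ x) : ℂ) * h ξ * 𝓕 w (ζ + a • ξ) := by
  have hint : Integrable (Function.uncurry fun (y ξ : E) =>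
      (Real.fourierChar (-inner ℝ y ζ - inner ℝ ξ (a • (y - x))) : ℂ) * (w y * h ξ))
      ((volume : Measure E).prod volume) := by
    refine (hw.mul_prod hh).bdd_mul (c := 1) ?_ (Eventually.of_forall fun p => ?_)
    · refine Continuous.aestronglyMeasurable ?_
      exact continuous_subtype_val.comp (Real.continuous_fourierChar.comp (by fun_prop))
    · exact (Circle.norm_coe _).le
  calc _ = ∫ y, ∫ ξ, (Real.fourierChar (-inner ℝ y ζ - inner ℝ ξ (a • (y - x))) : ℂ) *
        (w y * h ξ) := by
        rw [Real.fourier_eq]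
        refine integral_congr_ae (Eventually.of_forall fun y => ?_)
        beta_reduce
        rw [Real.fourier_eq, ← integral_mul_const, Circle.smul_def, smul_eq_mul, ← integral_const_mul]
        refine integral_congr_ae (Eventually.of_forall fun ξ => ?_)
        simp only [Circle.smul_def, smul_eq_mul]
        rw [sub_eq_add_neg (-inner ℝ y ζ), AddChar.map_add_eq_mul, Circle.coe_mul]
        ring
    _ = ∫ ξ, ∫ y, (Real.fourierChar (-inner ℝ y ζ - inner ℝ ξ (a • (y - x))) : ℂ) *
        (w y * h ξ) := integral_integral_swap hint
    _ = _ := by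
        refine integral_congr_ae (Eventually.of_forall fun ξ => ?_)
        beta_reduce
        rw [Real.fourier_eq, ← integral_const_mul]
        refine integral_congr_ae (Eventually.of_forall fun y => ?_)
        simp only [Circle.smul_def, smul_eq_mul]
        have e : -inner ℝ y ζ - inner ℝ ξ (a • (y - x)) =
            a * inner ℝ ξ x + -inner ℝ y (ζ + a • ξ) := by
          rw [inner_smul_right, inner_sub_right, inner_add_right, inner_smul_right,
            real_inner_comm y ξ]
          ring
        rw [e, AddChar.map_add_eq_mul, Circle.coe_mul]
        ring

/-- The transform of the product at `ζ` integrates `h(ξ)` against `𝓕w(ζ + aξ)`. On the support of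
`h` the shift has length at most `a`, so the spectrum lies within radius `2a + a`. -/
lemma lintegral_fourier_mul_le {h w : E → ℂ} (hh : Integrable h) (hw : Integrable w) {a : ℝ}
    (ha : 0 < a) (x : E) (hs : ∀ᵐ ξ, ξ ∉ Metric.closedBall (0 : E) 1 → h ξ = 0)
    (hw0 : ∀ ξ, 2 * a < ‖ξ‖ → 𝓕 w ξ = 0) {t : ℝ} (ht0 : 0 < t) (ht1 : t ≤ 1) :
    ∫⁻ y, ‖𝓕 h (a • (y - x)) * w y‖ₑ ≤ (volume (Metric.closedBall (0 : E) (3 * a)) ^ (1 - t) *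
      ∫⁻ y, ‖𝓕 h (a • (y - x)) * w y‖ₑ ^ t) ^ (1 / t) := by
  have hb : ∀ ξ, ‖𝓕 h ξ‖ ≤ ∫ x, ‖h x‖ := fun ξ =>
    VectorFourier.norm_fourierIntegral_le_integral_norm _ _ _ _ _
  have hc : Continuous fun y => 𝓕 h (a • (y - x)) :=
    (continuous_fourier_of_integrable hh).comp (by fun_prop)
  refine lintegral_enorm_le_of_fourier_eq_zero
    (hw.bdd_mul hc.aestronglyMeasurable (Eventually.of_forall fun y => hb _)) (fun ζ hζ => ?_) ht0 ht1
  rw [fourier_fourier_mul hh hw]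
  refine integral_eq_zero_of_ae ?_
  filter_upwards [hs] with ξ hξ
  by_cases h1 : ξ ∈ Metric.closedBall (0 : E) 1
  · rw [hw0, mul_zero, Pi.zero_apply]
    have h2 : ‖a • ξ‖ ≤ a := by
      rw [norm_smul, Real.norm_of_nonneg ha.le]
      exact mul_le_of_le_one_right ha.le (by simpa using h1)
    have h3 : ‖ζ‖ ≤ ‖ζ + a • ξ‖ + ‖a • ξ‖ := by
      simpa using norm_sub_le (ζ + a • ξ) (a • ξ)
    linarith
  · rw [hξ h1, mul_zero, zero_mul, Pi.zero_apply]

/-- The product of a band-limited function with the Fourier transform of a test function. -/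
lemma fourier_mul_fourier_eq_zero {V : 𝓢'(E, ℂ)} {v : E → ℂ} {ρ δ : ℝ}
    (hV : dsupport (𝓕 V : 𝓢'(E, ℂ)) ⊆ Metric.closedBall 0 ρ)
    (hv : ∀ ψ : 𝓢(E, ℂ), V ψ = ∫ x, v x * ψ x) (g : 𝓢(E, ℂ))
    (hg : tsupport g ⊆ Metric.closedBall 0 δ) (ζ : E) (hζ : ρ + δ < ‖ζ‖) :
    𝓕 (fun y => v y * 𝓕 (g : E → ℂ) y) ζ = 0 := by
  -- The transform of `v · 𝓕g` at `ζ` is `𝓕V` applied to the translate of `g` by `ζ`, whose support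
  -- misses the ball of radius `ρ` when `‖ζ‖ > ρ + δ`.
  let g' : 𝓢(E, ℂ) := SchwartzMap.compSubConstCLM ℂ ζ g
  have h1 : tsupport g' ⊆ Metric.closedBall ζ δ := by
    refine closure_minimal (fun y hy => ?_) Metric.isClosed_closedBall
    have : y - ζ ∈ tsupport g := subset_tsupport _ hy
    simpa [dist_eq_norm] using hg this
  have h2 : (𝓕 V : 𝓢'(E, ℂ)) g' = 0 := by
    refine apply_eq_zero_of_disjoint_dsupport _ _ fun y hy hy' => ?_
    have h3 := h1 hy
    have h4 := hV hy'
    rw [Metric.mem_closedBall, dist_eq_norm] at h3 h4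
    have : ‖ζ‖ ≤ ‖y - 0‖ + ‖y - ζ‖ := by
      have := norm_sub_le (y - 0) (y - ζ)
      simpa using this
    linarith
  rw [TemperedDistribution.fourier_apply, hv] at h2
  rw [Real.fourier_eq, ← h2]
  refine integral_congr_ae (Eventually.of_forall fun y => ?_)
  have h5 : (𝓕 g' : 𝓢(E, ℂ)) y = Real.fourierChar (-inner ℝ y ζ) • 𝓕 (g : E → ℂ) y := by
    have := congrFun (VectorFourier.fourierIntegral_comp_add_right Real.fourierChar volume
      (innerₗ E) (g : E → ℂ) (-ζ)) y
    rw [SchwartzMap.fourier_coe]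
    have e : (g' : E → ℂ) = g ∘ fun z => z + -ζ := by
      ext z
      simp [g', sub_eq_add_neg]
    rw [e]
    refine this.trans ?_
    simp only [innerₗ_apply_apply, inner_neg_left, real_inner_comm]
    rfl
  beta_reduce
  rw [h5, Circle.smul_def, Circle.smul_def]
  simp only [smul_eq_mul]
  ring

/-- Regularising factors with small spectrum. -/
lemma exists_fourier_approx_one {a : ℝ} (ha : 0 < a) :
    ∃ g : ℕ → 𝓢(E, ℂ), (∀ m, tsupport (g m) ⊆ Metric.closedBall 0 a) ∧
      (∀ m y, ‖𝓕 (g m : E → ℂ) y‖ₑ ≤ 1) ∧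
      ∀ y, Tendsto (fun m => 𝓕 (g m : E → ℂ) y) atTop (𝓝 1) := by
  let φ : ℕ → ContDiffBump (0 : E) := fun m => ⟨a / (m + 1) / 2, a / (m + 1), by positivity,
    half_lt_self (by positivity)⟩
  have hφ : ∀ m, (φ m).rOut = a / (m + 1) := fun m => rfl
  have hc : ∀ m, HasCompactSupport fun x => (((φ m).normed volume x : ℝ) : ℂ) := fun m =>
    (φ m).hasCompactSupport_normed.comp_left (g := Complex.ofReal) rfl
  let g : ℕ → 𝓢(E, ℂ) := fun m => (hc m).toSchwartzMap
    (Complex.ofRealCLM.contDiff.comp (φ m).contDiff_normed)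
  have hg : ∀ m x, g m x = (((φ m).normed volume x : ℝ) : ℂ) := fun m x => rfl
  refine ⟨g, fun m => ?_, fun m y => ?_, fun y => ?_⟩
  · refine (tsupport_comp_subset (g := Complex.ofReal) rfl ((φ m).normed volume)).trans ?_
    rw [(φ m).tsupport_normed_eq, hφ]
    exact Metric.closedBall_subset_closedBall (div_le_self ha.le (by simp))
  · refine (enorm_fourier_le _ y).trans (le_of_eq ?_)
    have : ∀ x, ‖g m x‖ₑ = ENNReal.ofReal ((φ m).normed volume x) := fun x => by
      rw [← ofReal_norm, hg, Complex.norm_real, Real.norm_of_nonneg ((φ m).nonneg_normed x)]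
    simp only [this]
    rw [← ofReal_integral_eq_lintegral_ofReal (φ m).integrable_normed
      (Eventually.of_forall fun x => (φ m).nonneg_normed x), (φ m).integral_normed,
      ENNReal.ofReal_one]
  · have hlim : Tendsto (fun m => (φ m).rOut) atTop (𝓝 0) := by
      have := (tendsto_one_div_add_atTop_nhds_zero_nat (𝕜 := ℝ)).const_mul a
      simpa [hφ, div_eq_mul_inv] using this
    -- The transform at `y` averages a character against a bump of mass one; convolution at the
    -- point `0` reverses the argument and so gives the phase its sign.
    have h := ContDiffBump.convolution_tendsto_right_of_continuous (μ := (volume : Measure E))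
      (g := fun x => (Real.fourierChar (inner ℝ x y) : ℂ)) hlim
      (continuous_subtype_val.comp (Real.continuous_fourierChar.comp (by fun_prop))) 0
    simp only [inner_zero_left, AddChar.map_zero_eq_one, Circle.coe_one] at h
    refine h.congr fun m => ?_
    rw [MeasureTheory.convolution_def, Real.fourier_eq]
    refine integral_congr_ae (Eventually.of_forall fun x => ?_)
    simp [hg, Circle.smul_def, mul_comm]

/-- The Nikolskij inequality for the product of a kernel and a band-limited function. -/
lemma lintegral_fourier_mul_le_of_dsupport {h : E → ℂ} (hh : Integrable h) {a : ℝ}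
    (ha : 0 < a) (x : E) (hs : ∀ᵐ ξ, ξ ∉ Metric.closedBall (0 : E) 1 → h ξ = 0)
    {V : 𝓢'(E, ℂ)} {v : E → ℂ} (hV : dsupport (𝓕 V : 𝓢'(E, ℂ)) ⊆ Metric.closedBall 0 a)
    (hvm : AEStronglyMeasurable v)
    (hv : ∀ ψ : 𝓢(E, ℂ), Integrable (fun x => v x * ψ x) ∧ V ψ = ∫ x, v x * ψ x)
    {t : ℝ} (ht0 : 0 < t) (ht1 : t ≤ 1) :
    ∫⁻ y, ‖𝓕 h (a • (y - x)) * v y‖ₑ ≤ (volume (Metric.closedBall (0 : E) (3 * a)) ^ (1 - t) *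
      ∫⁻ y, ‖𝓕 h (a • (y - x)) * v y‖ₑ ^ t) ^ (1 / t) := by
  -- Since `v` need not be integrable, Nikolskij is applied to `v · 𝓕(g m)`, of spectrum within `a +
  -- a`. The bound is uniform in `m` because `|𝓕(g m)| ≤ 1`, and Fatou's lemma removes the
  -- regularisation.
  obtain ⟨g, hg1, hg2, hg3⟩ := exists_fourier_approx_one (E := E) ha
  have hc : Continuous fun y => 𝓕 h (a • (y - x)) :=
    (continuous_fourier_of_integrable hh).comp (by fun_prop)
  have hm : ∀ m, ∫⁻ y, ‖𝓕 h (a • (y - x)) * (v y * 𝓕 (g m : E → ℂ) y)‖ₑ ≤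
      (volume (Metric.closedBall (0 : E) (3 * a)) ^ (1 - t) *
        ∫⁻ y, ‖𝓕 h (a • (y - x)) * v y‖ₑ ^ t) ^ (1 / t) := by
    intro m
    have hw : Integrable fun y => v y * 𝓕 (g m : E → ℂ) y := by
      rw [← SchwartzMap.fourier_coe]
      exact (hv (𝓕 (g m))).1
    refine (lintegral_fourier_mul_le hh hw ha x hs (fun ξ hξ => fourier_mul_fourier_eq_zero hV
      (fun ψ => (hv ψ).2) (g m) (hg1 m) ξ (by linarith)) ht0 ht1).trans ?_
    gcongr with y
    rw [← mul_assoc, enorm_mul]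
    exact mul_le_of_le_one_right zero_le (hg2 m y)
  have hlim : ∀ y, Tendsto (fun m => ‖𝓕 h (a • (y - x)) * (v y * 𝓕 (g m : E → ℂ) y)‖ₑ) atTop
      (𝓝 ‖𝓕 h (a • (y - x)) * v y‖ₑ) := by
    intro y
    have := (((hg3 y).const_mul (v y)).const_mul (𝓕 h (a • (y - x)))).enorm
    rwa [mul_one] at this
  calc ∫⁻ y, ‖𝓕 h (a • (y - x)) * v y‖ₑ
      = ∫⁻ y, liminf (fun m => ‖𝓕 h (a • (y - x)) * (v y * 𝓕 (g m : E → ℂ) y)‖ₑ) atTop :=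
        lintegral_congr fun y => (hlim y).liminf_eq.symm
    _ ≤ liminf (fun m => ∫⁻ y, ‖𝓕 h (a • (y - x)) * (v y * 𝓕 (g m : E → ℂ) y)‖ₑ) atTop := by
        refine lintegral_liminf_le' fun m => ?_
        refine (hc.aestronglyMeasurable.mul (hvm.mul ?_)).enorm
        exact (continuous_fourier_of_integrable (g m).integrable).aestronglyMeasurable
    _ ≤ _ := liminf_le_of_le (by isBoundedDefault) fun b hb => by
        obtain ⟨m, hm'⟩ := hb.exists
        exact hm'.trans (hm m)

end Nikolskij

/-! ### Littlewood-Paley pieces, the maximal function and the estimate for fixed `x`. -/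

section DyadicEstimate

variable {E : Type} [NormedAddCommGroup E] [InnerProductSpace ℝ E] [FiniteDimensional ℝ E]
  [MeasurableSpace E] [BorelSpace E]

lemma lpPhi_apply (Ψ : ℝ → ℝ) (j : ℤ) (η : E) :
    lpPhi Ψ j η = Ψ ((2 : ℝ) ^ (1 - j) * ‖η‖ / 2) - Ψ ((2 : ℝ) ^ (1 - j) * ‖η‖) := by
  rw [lpPhi, lpPhiOne, norm_smul, Real.norm_of_nonneg (by positivity)]

/-- A Littlewood-Paley piece on the Fourier side is bounded by its `L¹` norm. -/
lemma enorm_lpPhi_mul_fourier_le {Ψ : ℝ → ℝ} (hΨ : IsLPCutoff Ψ) (j : ℤ) {h : E → ℂ}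
    (hh : Integrable h) (ξ : E) :
    ‖(lpPhi Ψ j ((2 * Real.pi) • ξ) : ℂ) * 𝓕 h ξ‖ₑ ≤ eLpNorm (lpPiece Ψ j h) 1 volume := by
  set m : E → ℂ := fun ξ => (lpPhi Ψ j ((2 * Real.pi) • ξ) : ℂ) * 𝓕 h ξ with hm
  have hmc : Continuous m := by
    have h1 : Continuous fun ξ : E => lpPhi Ψ j ((2 * Real.pi) • ξ) := by
      simp only [lpPhi_apply]
      have := hΨ.1.continuous
      fun_prop
    exact (Complex.continuous_ofReal.comp h1).mul (continuous_fourier_of_integrable hh)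
  have hms : HasCompactSupport m := by
    refine HasCompactSupport.intro
      (isCompact_closedBall (0 : E) (26 / 10 / ((2 : ℝ) ^ (1 - j) * (2 * Real.pi)))) fun ξ hξ => ?_
    have h2 : 26 / 10 < (2 : ℝ) ^ (1 - j) * ‖(2 * Real.pi) • ξ‖ := by
      rw [mem_closedBall_zero_iff, not_le, div_lt_iff₀ (by positivity)] at hξ
      rw [norm_smul, Real.norm_of_nonneg (by positivity)]
      linarith
    simp only [hm]
    rw [lpPhi_apply, hΨ.2.2 _ (by linarith), hΨ.2.2 _ (by linarith)]
    simp
  have hmi : Integrable m := hmc.integrable_of_hasCompactSupport hms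
  -- If the piece is not integrable there is nothing to prove; otherwise inversion gives `m =
  -- 𝓕(𝓕⁻m)`, and the sup norm of a transform is at most the `L₁` norm.
  by_cases htop : eLpNorm (lpPiece Ψ j h) 1 volume = ⊤
  · rw [htop]; exact le_top
  have hc : Continuous (𝓕⁻ m) := by
    refine ((continuous_fourier_of_integrable hmi).comp continuous_neg).congr fun x => ?_
    rw [Real.fourierInv_eq_fourier_neg]
    rfl
  have hi : Integrable (𝓕⁻ m) :=
    memLp_one_iff_integrable.1 ⟨hc.aestronglyMeasurable, lt_top_iff_ne_top.2 htop⟩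
  have hF : Integrable (𝓕 m) := by
    refine hi.comp_neg.congr (Eventually.of_forall fun x => ?_)
    simp [Real.fourierInv_eq_fourier_neg]
  have hinv : 𝓕 (𝓕⁻ m) = m := hmc.fourier_fourierInv_eq hmi hF
  change ‖m ξ‖ₑ ≤ _
  rw [← congrFun hinv ξ, eLpNorm_one_eq_lintegral_enorm]
  exact enorm_fourier_le _ ξ

/-- With `s = 2^{1-m}‖η‖` the sum telescopes to `Ψ(s/4) - Ψ(s)`; on this annulus `2 ≤ s ≤ 4`, where
`Ψ(s) = 0` and `Ψ(s/4) = 1`. -/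
lemma lpPhi_add_lpPhi_succ {Ψ : ℝ → ℝ} (hΨ : IsLPCutoff Ψ) (m : ℤ) (η : E)
    (h1 : (2 : ℝ) ^ m ≤ ‖η‖) (h2 : ‖η‖ < (2 : ℝ) ^ (m + 1)) :
    lpPhi Ψ m η + lpPhi Ψ (m + 1) η = 1 := by
  have e1 : (2 : ℝ) ^ (1 - (m + 1)) = (2 : ℝ) ^ (1 - m) / 2 := by
    rw [show (1 : ℤ) - (m + 1) = (1 - m) - 1 by ring, zpow_sub_one₀ two_ne_zero, div_eq_mul_inv]
  have e2 : (2 : ℝ) ^ (1 - m) * (2 : ℝ) ^ m = 2 := by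
    rw [← zpow_add₀ two_ne_zero]; simp
  have hp : (0 : ℝ) < (2 : ℝ) ^ (1 - m) := by positivity
  have h3 : 2 ≤ (2 : ℝ) ^ (1 - m) * ‖η‖ := by
    calc (2 : ℝ) = (2 : ℝ) ^ (1 - m) * (2 : ℝ) ^ m := e2.symm
      _ ≤ _ := by gcongr
  have h4 : (2 : ℝ) ^ (1 - m) * ‖η‖ ≤ 4 := by
    calc (2 : ℝ) ^ (1 - m) * ‖η‖ ≤ (2 : ℝ) ^ (1 - m) * (2 : ℝ) ^ (m + 1) := by gcongr
      _ = 4 := by rw [zpow_add_one₀ two_ne_zero, ← mul_assoc, e2]; norm_num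
  rw [lpPhi_apply, lpPhi_apply, e1, hΨ.2.2 ((2 : ℝ) ^ (1 - m) * ‖η‖) (by linarith),
    hΨ.2.1 ((2 : ℝ) ^ (1 - m) / 2 * ‖η‖ / 2) (by linarith)]
  rw [show (2 : ℝ) ^ (1 - m) / 2 * ‖η‖ = (2 : ℝ) ^ (1 - m) * ‖η‖ / 2 by ring]
  ring

/-- The Fourier transform is controlled pointwise by the dyadic pieces. -/
lemma enorm_fourier_rpow_le_tsum {Ψ : ℝ → ℝ} (hΨ : IsLPCutoff Ψ) {h : E → ℂ}
    (hh : Integrable h) {t : ℝ} (ht0 : 0 < t) (ht1 : t ≤ 1) {ξ : E} (hξ : ξ ≠ 0) :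
    ‖𝓕 h ξ‖ₑ ^ t ≤ ∑' j : ℤ, (Metric.ball (0 : E) ((2 : ℝ) ^ (j + 1) / (2 * Real.pi))).indicator
      (fun _ => eLpNorm (lpPiece Ψ j h) 1 volume ^ t) ξ := by
  have hη : 0 < ‖(2 * Real.pi) • ξ‖ := norm_pos_iff.2 (smul_ne_zero (by positivity) hξ)
  obtain ⟨m, hm1, hm2⟩ := exists_mem_Ico_zpow hη one_lt_two
  have hsum : 𝓕 h ξ = (lpPhi Ψ m ((2 * Real.pi) • ξ) : ℂ) * 𝓕 h ξ +
      (lpPhi Ψ (m + 1) ((2 * Real.pi) • ξ) : ℂ) * 𝓕 h ξ := by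
    rw [← add_mul, ← Complex.ofReal_add, lpPhi_add_lpPhi_succ hΨ m _ hm1 hm2, Complex.ofReal_one,
      one_mul]
  rw [norm_smul, Real.norm_of_nonneg (by positivity)] at hm2
  -- Annuli are enlarged to balls, since the maximal function averages over balls; both relevant
  -- indices, `m` and `m + 1`, are at least `m`.
  have hmem : ∀ j : ℤ, m ≤ j → ξ ∈ Metric.ball (0 : E) ((2 : ℝ) ^ (j + 1) / (2 * Real.pi)) := by
    intro j hj
    rw [mem_ball_zero_iff, lt_div_iff₀ (by positivity), mul_comm]
    exact hm2.trans_le (zpow_le_zpow_right₀ one_le_two (by omega))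
  calc ‖𝓕 h ξ‖ₑ ^ t ≤ (eLpNorm (lpPiece Ψ m h) 1 volume +
        eLpNorm (lpPiece Ψ (m + 1) h) 1 volume) ^ t := by
        gcongr
        rw [hsum]
        exact (enorm_add_le _ _).trans (add_le_add (enorm_lpPhi_mul_fourier_le hΨ m hh ξ)
          (enorm_lpPhi_mul_fourier_le hΨ (m + 1) hh ξ))
    _ ≤ eLpNorm (lpPiece Ψ m h) 1 volume ^ t + eLpNorm (lpPiece Ψ (m + 1) h) 1 volume ^ t :=
        ENNReal.rpow_add_le_add_rpow _ _ ht0.le ht1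
    _ = ∑ j ∈ {m, m + 1}, (Metric.ball (0 : E) ((2 : ℝ) ^ (j + 1) / (2 * Real.pi))).indicator
        (fun _ => eLpNorm (lpPiece Ψ j h) 1 volume ^ t) ξ := by
        rw [Finset.sum_pair (by omega), indicator_of_mem (hmem m le_rfl),
          indicator_of_mem (hmem (m + 1) (by omega))]
    _ ≤ _ := ENNReal.sum_le_tsum _

lemma lintegral_ball_le_maximalFunction {t : ℝ} (ht0 : 0 < t) (f : E → ℂ) (x : E) {r : ℝ}
    (hr : 0 < r) : ∫⁻ y in Metric.ball x r, ‖f y‖ₑ ^ t ≤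
      volume (Metric.ball x r) * maximalFunction t f x ^ t := by
  have h1 : ((volume (Metric.ball x r))⁻¹ * ∫⁻ y in Metric.ball x r, ‖f y‖ₑ ^ t) ^ (1 / t) ≤
      maximalFunction t f x := le_iSup₂ (f := fun (r : ℝ) (_ : 0 < r) =>
        ((volume (Metric.ball x r))⁻¹ * ∫⁻ y in Metric.ball x r, ‖f y‖ₑ ^ t) ^ (1 / t)) r hr
  rw [one_div, ENNReal.rpow_inv_le_iff ht0] at h1
  rwa [← ENNReal.inv_mul_le_iff (Metric.measure_ball_pos volume x hr).ne' measure_ball_lt_top.ne]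

lemma homBesovNorm_rpow (Ψ : ℝ → ℝ) (s : ℝ) (p : ℝ≥0∞) {q : ℝ} (hq : 0 < q) (f : E → ℂ) :
    homBesovNorm Ψ s p q f ^ q = ∑' j : ℤ, ENNReal.ofReal ((2 : ℝ) ^ (s * j * q)) *
      (eLpNorm (lpPiece Ψ j f) p volume) ^ q := by
  rw [homBesovNorm, ← ENNReal.rpow_mul, one_div_mul_cancel hq.ne', ENNReal.rpow_one]

/-- The factor `2^{jn}` is written as `2^{(n/t)jt}` to match the weight in the Besov norm of order
`n/t`. -/
lemma volume_ball_dyadic (x : E) {t : ℝ} (ht0 : 0 < t) {a : ℝ} (ha : 0 < a) (j : ℤ) :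
    volume (Metric.ball x ((2 : ℝ) ^ (j + 1) / (2 * Real.pi) / a)) =
      (ENNReal.ofReal (a ^ Module.finrank ℝ E))⁻¹ *
        (ENNReal.ofReal ((Real.pi ^ Module.finrank ℝ E)⁻¹) * volume (Metric.ball (0 : E) 1)) *
          ENNReal.ofReal ((2 : ℝ) ^ ((Module.finrank ℝ E : ℝ) / t * j * t)) := by
  rw [Measure.addHaar_ball_of_pos _ _ (by positivity),
    ← ENNReal.ofReal_inv_of_pos (by positivity)]
  have e : ((2 : ℝ) ^ (j + 1) / (2 * Real.pi) / a) ^ Module.finrank ℝ E =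
      (a ^ Module.finrank ℝ E)⁻¹ * (Real.pi ^ Module.finrank ℝ E)⁻¹ *
        (2 : ℝ) ^ ((Module.finrank ℝ E : ℝ) / t * j * t) := by
    have e1 : (Module.finrank ℝ E : ℝ) / t * j * t = (j : ℝ) * (Module.finrank ℝ E : ℝ) := by
      field_simp
    rw [e1, Real.rpow_mul two_pos.le, Real.rpow_natCast, Real.rpow_intCast,
      zpow_add_one₀ two_ne_zero, ← mul_inv, ← mul_pow, ← inv_pow, ← mul_pow]
    congr 1
    field_simp
  rw [e, ENNReal.ofReal_mul (by positivity), ENNReal.ofReal_mul (by positivity)]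
  ring

/-- The `L_t` estimate of the kernel times `v` by the Besov norm and the maximal function. -/
lemma lintegral_fourier_mul_rpow_le [Nontrivial E] {Ψ : ℝ → ℝ} (hΨ : IsLPCutoff Ψ) {h : E → ℂ}
    (hh : Integrable h) {a : ℝ} (ha : 0 < a) (x : E) {v : E → ℂ} (hv : AEStronglyMeasurable v)
    {t : ℝ} (ht0 : 0 < t) (ht1 : t ≤ 1) :
    ∫⁻ y, ‖𝓕 h (a • (y - x)) * v y‖ₑ ^ t ≤ (ENNReal.ofReal (a ^ Module.finrank ℝ E))⁻¹ *
      (ENNReal.ofReal ((Real.pi ^ Module.finrank ℝ E)⁻¹) * volume (Metric.ball (0 : E) 1)) *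
      (homBesovNorm Ψ (Module.finrank ℝ E / t) 1 t h * maximalFunction t v x) ^ t := by
  set A : ℤ → ℝ≥0∞ := fun j => eLpNorm (lpPiece Ψ j h) 1 volume ^ t with hA
  set B : ℤ → Set E := fun j => Metric.ball x ((2 : ℝ) ^ (j + 1) / (2 * Real.pi) / a) with hB
  have hmem : ∀ j y, a • (y - x) ∈ Metric.ball (0 : E) ((2 : ℝ) ^ (j + 1) / (2 * Real.pi)) ↔
      y ∈ B j := by
    intro j y
    rw [mem_ball_zero_iff, norm_smul, Real.norm_of_nonneg ha.le, hB, Metric.mem_ball, dist_eq_norm,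
      lt_div_iff₀ ha, mul_comm]
  have hpt : ∀ᵐ y, ‖𝓕 h (a • (y - x)) * v y‖ₑ ^ t ≤
      ∑' j, (B j).indicator (fun y => A j * ‖v y‖ₑ ^ t) y := by
    -- The dyadic pieces do not cover the origin, but a point is null in a nontrivial space.
    have hne : ∀ᵐ y, y ≠ x := by simp [ae_iff]
    filter_upwards [hne] with y hy
    rw [enorm_mul, ENNReal.mul_rpow_of_nonneg _ _ ht0.le]
    have h1 := enorm_fourier_rpow_le_tsum hΨ hh ht0 ht1
      (smul_ne_zero ha.ne' (sub_ne_zero.2 hy))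
    calc _ ≤ _ := mul_le_mul_left h1 (‖v y‖ₑ ^ t)
      _ = _ := by
        rw [← ENNReal.tsum_mul_right]
        refine tsum_congr fun j => ?_
        by_cases hj : y ∈ B j
        · rw [indicator_of_mem hj, indicator_of_mem ((hmem j y).2 hj)]
        · rw [indicator_of_notMem hj, indicator_of_notMem (fun h => hj ((hmem j y).1 h)), zero_mul]
  have hvm : AEMeasurable fun y => ‖v y‖ₑ ^ t := hv.enorm.pow_const t
  calc _ ≤ ∫⁻ y, ∑' j, (B j).indicator (fun y => A j * ‖v y‖ₑ ^ t) y := lintegral_mono_ae hpt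
    _ = ∑' j, ∫⁻ y, (B j).indicator (fun y => A j * ‖v y‖ₑ ^ t) y :=
        lintegral_tsum fun j => (hvm.const_mul _).indicator measurableSet_ball
    _ = ∑' j, A j * ∫⁻ y in B j, ‖v y‖ₑ ^ t := by
        refine tsum_congr fun j => ?_
        rw [lintegral_indicator measurableSet_ball, lintegral_const_mul'' _ hvm.restrict]
    _ ≤ ∑' j, A j * (volume (B j) * maximalFunction t v x ^ t) := by
        refine ENNReal.tsum_le_tsum fun j => mul_le_mul_right ?_ _
        exact lintegral_ball_le_maximalFunction ht0 v x (by positivity)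
    _ = _ := by
        rw [ENNReal.mul_rpow_of_nonneg _ _ ht0.le, homBesovNorm_rpow _ _ _ ht0,
          ← ENNReal.tsum_mul_right, ← ENNReal.tsum_mul_left]
        refine tsum_congr fun j => ?_
        rw [hB, volume_ball_dyadic x ht0 ha]
        ring

/-- The constant in Marschall's inequality. -/
noncomputable def marschallConst (E : Type) [NormedAddCommGroup E] [InnerProductSpace ℝ E]
    [FiniteDimensional ℝ E] [MeasurableSpace E] [BorelSpace E] (t : ℝ) : ℝ≥0∞ :=
  ((ENNReal.ofReal (3 ^ Module.finrank ℝ E) * volume (Metric.ball (0 : E) 1)) ^ (1 - t) *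
    (ENNReal.ofReal ((Real.pi ^ Module.finrank ℝ E)⁻¹) * volume (Metric.ball (0 : E) 1))) ^ (1 / t)

lemma marschallConst_ne_top {t : ℝ} (ht0 : 0 < t) (ht1 : t ≤ 1) : marschallConst E t ≠ ⊤ := by
  refine ENNReal.rpow_ne_top_of_nonneg (by positivity) (ENNReal.mul_ne_top
    (ENNReal.rpow_ne_top_of_nonneg (by linarith) ?_) ?_) <;>
  exact ENNReal.mul_ne_top ENNReal.ofReal_ne_top measure_ball_lt_top.ne

/-- Marschall's inequality for a fixed `x`, in terms of the rescaled symbol `h`. -/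
lemma lintegral_fourier_mul_le_besov_mul_maximal [Nontrivial E] {Ψ : ℝ → ℝ} (hΨ : IsLPCutoff Ψ)
    {h : E → ℂ} (hh : Integrable h) {a : ℝ}
    (ha : 0 < a) (x : E) (hs : ∀ᵐ ξ, ξ ∉ Metric.closedBall (0 : E) 1 → h ξ = 0)
    {V : 𝓢'(E, ℂ)} {v : E → ℂ} (hV : dsupport (𝓕 V : 𝓢'(E, ℂ)) ⊆ Metric.closedBall 0 a)
    (hvm : AEStronglyMeasurable v)
    (hv : ∀ ψ : 𝓢(E, ℂ), Integrable (fun x => v x * ψ x) ∧ V ψ = ∫ x, v x * ψ x)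
    {t : ℝ} (ht0 : 0 < t) (ht1 : t ≤ 1) :
    ENNReal.ofReal (a ^ Module.finrank ℝ E) * ∫⁻ y, ‖𝓕 h (a • (y - x)) * v y‖ₑ ≤
      marschallConst E t *
        (homBesovNorm Ψ (Module.finrank ℝ E / t) 1 t h * maximalFunction t v x) := by
  set α := ENNReal.ofReal (a ^ Module.finrank ℝ E) with hα
  have hα0 : α ≠ 0 := by rw [hα]; simp only [ne_eq, ENNReal.ofReal_eq_zero, not_le]; positivity
  have hαt : α ≠ ⊤ := ENNReal.ofReal_ne_top
  have ht : 0 ≤ 1 - t := by linarith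
  have hvol : volume (Metric.closedBall (0 : E) (3 * a)) =
      α * (ENNReal.ofReal (3 ^ Module.finrank ℝ E) * volume (Metric.ball (0 : E) 1)) := by
    rw [Measure.addHaar_closedBall _ _ (by positivity), mul_pow,
      ENNReal.ofReal_mul (by positivity), ← hα]
    ring
  have key : ∫⁻ y, ‖𝓕 h (a • (y - x)) * v y‖ₑ ≤ α⁻¹ * (marschallConst E t *
        (homBesovNorm Ψ (Module.finrank ℝ E / t) 1 t h * maximalFunction t v x)) := by
    refine (lintegral_fourier_mul_le_of_dsupport hh ha x hs hV hvm hv ht0 ht1).trans ?_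
    calc _ ≤ (α ^ (1 - t) * (ENNReal.ofReal (3 ^ Module.finrank ℝ E) *
          volume (Metric.ball (0 : E) 1)) ^ (1 - t) * (α⁻¹ *
          (ENNReal.ofReal ((Real.pi ^ Module.finrank ℝ E)⁻¹) * volume (Metric.ball (0 : E) 1)) *
          (homBesovNorm Ψ (Module.finrank ℝ E / t) 1 t h * maximalFunction t v x) ^ t)) ^ (1 / t) := by
          rw [hvol, ENNReal.mul_rpow_of_nonneg _ _ ht]
          gcongr
          exact lintegral_fourier_mul_rpow_le hΨ hh ha x hvm ht0 ht1
      _ = ((α⁻¹) ^ t * ((ENNReal.ofReal (3 ^ Module.finrank ℝ E) *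
          volume (Metric.ball (0 : E) 1)) ^ (1 - t) *
          (ENNReal.ofReal ((Real.pi ^ Module.finrank ℝ E)⁻¹) * volume (Metric.ball (0 : E) 1))) *
          (homBesovNorm Ψ (Module.finrank ℝ E / t) 1 t h * maximalFunction t v x) ^ t) ^ (1 / t) := by
          -- Nikolskij contributes `α^{1-t}` and the ball volumes `α⁻¹`; the power `1/t` of their
          -- product is `α⁻¹`, which cancels the factor `α` of the kernel.
          have e : α ^ (1 - t) * α⁻¹ = (α⁻¹) ^ t := by
            rw [ENNReal.inv_rpow, ← ENNReal.rpow_neg, ← ENNReal.rpow_neg_one,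
              ← ENNReal.rpow_add _ _ hα0 hαt]
            congr 1
            ring
          rw [← e]
          congr 1
          ring
      _ = _ := by
          have h0 : 0 ≤ 1 / t := by positivity
          rw [ENNReal.mul_rpow_of_nonneg _ _ h0, ENNReal.mul_rpow_of_nonneg _ _ h0,
            ← ENNReal.rpow_mul, ← ENNReal.rpow_mul, mul_one_div_cancel ht0.ne', ENNReal.rpow_one,
            ENNReal.rpow_one, marschallConst, mul_assoc]
  calc _ ≤ α * (α⁻¹ * (marschallConst E t *
        (homBesovNorm Ψ (Module.finrank ℝ E / t) 1 t h * maximalFunction t v x))) := by gcongr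
    _ = _ := by rw [← mul_assoc, ENNReal.mul_inv_cancel hα0 hαt, one_mul]

end DyadicEstimate

/-! ### The distribution kernel as an oscillatory integral of the symbol. -/

section Kernel

variable {E : Type} [NormedAddCommGroup E] [InnerProductSpace ℝ E] [FiniteDimensional ℝ E]
  [MeasurableSpace E] [BorelSpace E]

lemma IsGivenBy.congr_ae {X : Type} [NormedAddCommGroup X] [NormedSpace ℝ X] [MeasureSpace X]
    {T : 𝓢'(X, ℂ)} {f g : X → ℂ} (hf : IsGivenBy T f) (h : f =ᵐ[volume] g) : IsGivenBy T g := by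
  refine ⟨hf.1.congr h, fun ψ hψ => (hf.2 ψ hψ).trans (integral_congr_ae ?_)⟩
  filter_upwards [h] with x hx
  rw [hx]

/-- A measurable representative of the symbol which vanishes off the support. -/
lemma exists_stronglyMeasurable_symbol {B : 𝓢'(E × E, ℂ)} {b : E × E → ℂ} (hb : IsGivenBy B b)
    {R : ℝ} (hB : dsupport B ⊆ univ ×ˢ Metric.closedBall 0 R) :
    ∃ β : E × E → ℂ, StronglyMeasurable β ∧ b =ᵐ[volume] β ∧ IsGivenBy B β ∧
      ∀ x ξ, ξ ∉ Metric.closedBall (0 : E) R → β (x, ξ) = 0 := by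
  have hm := hb.1.aestronglyMeasurable
  have hS : IsClosed ((univ : Set E) ×ˢ Metric.closedBall (0 : E) R) :=
    isClosed_univ.prod Metric.isClosed_closedBall
  have hbβ : b =ᵐ[volume] ((univ : Set E) ×ˢ Metric.closedBall (0 : E) R).indicator (hm.mk b) := by
    filter_upwards [hm.ae_eq_mk, ae_eq_zero_of_isGivenBy hb hS hB] with p hp hp0
    by_cases h : p ∈ (univ : Set E) ×ˢ Metric.closedBall (0 : E) R
    · rw [indicator_of_mem h, hp]
    · rw [indicator_of_notMem h, hp0 h]
  refine ⟨_, hm.stronglyMeasurable_mk.indicator hS.measurableSet, hbβ, hb.congr_ae hbβ,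
    fun x ξ hξ => indicator_of_notMem (fun h => hξ h.2) _⟩

/-- Compact support in `ξ` upgrades local integrability to integrability over a compact set of `x`
and all `ξ`, which makes Fubini available. -/
lemma integrable_restrict_prod_of_eq_zero {β : E × E → ℂ} (hβ : LocallyIntegrable β) {R : ℝ}
    (h0 : ∀ x ξ, ξ ∉ Metric.closedBall (0 : E) R → β (x, ξ) = 0) (r : ℝ) :
    Integrable β ((volume.restrict (Metric.closedBall (0 : E) r)).prod (volume : Measure E)) := by
  have h1 : IntegrableOn β (Metric.closedBall (0 : E) r ×ˢ Metric.closedBall (0 : E) R) :=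
    hβ.integrableOn_isCompact ((isCompact_closedBall _ _).prod (isCompact_closedBall _ _))
  have h2 : IntegrableOn β (Metric.closedBall (0 : E) r ×ˢ (univ : Set E)) := by
    refine h1.of_forall_sdiff_eq_zero
      (Metric.isClosed_closedBall.measurableSet.prod MeasurableSet.univ) fun p hp => ?_
    exact h0 p.1 p.2 fun h => hp.2 ⟨hp.1.1, h⟩
  rwa [IntegrableOn, Measure.volume_eq_prod, ← Measure.prod_restrict, Measure.restrict_univ] at h2

lemma ae_integrable_slice {β : E × E → ℂ} (hβ : LocallyIntegrable β) {R : ℝ}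
    (h0 : ∀ x ξ, ξ ∉ Metric.closedBall (0 : E) R → β (x, ξ) = 0) :
    ∀ᵐ x : E, Integrable fun ξ => β (x, ξ) := by
  have h1 : ∀ r : ℕ, ∀ᵐ x : E, x ∈ Metric.closedBall (0 : E) r → Integrable fun ξ => β (x, ξ) :=
    fun r => (ae_restrict_iff' Metric.isClosed_closedBall.measurableSet).1
      (integrable_restrict_prod_of_eq_zero hβ h0 r).prod_right_ae
  filter_upwards [ae_all_iff.2 h1] with x hx
  exact hx ⌈‖x‖⌉₊ (by simpa using Nat.le_ceil ‖x‖)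

/-- The kernel function `(2π)⁻ⁿ ∫ e^{i(x-y)·ξ} β(x, ξ) dξ`. -/
noncomputable def symbolKernel (β : E × E → ℂ) (p : E × E) : ℂ :=
  ((((2 * Real.pi) ^ Module.finrank ℝ E)⁻¹ : ℝ) : ℂ) *
    ∫ ξ, Complex.exp (Complex.I * (inner ℝ (p.1 - p.2) ξ : ℝ)) * β (p.1, ξ)

lemma norm_exp_I_mul_inner (x y : E) : ‖Complex.exp (Complex.I * (inner ℝ x y : ℝ))‖ = 1 := by
  rw [mul_comm, Complex.norm_exp_ofReal_mul_I]

/-- The substitution `ξ ↦ Rξ` moves the symbol to the unit ball and isolates the scale `R / 2π`. -/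
lemma symbolKernel_eq_fourier (β : E × E → ℂ) {R : ℝ} (hR : 0 < R) (x y : E) :
    symbolKernel β (x, y) = (((R / (2 * Real.pi)) ^ Module.finrank ℝ E : ℝ) : ℂ) *
      𝓕 (fun ξ => β (x, R • ξ)) ((R / (2 * Real.pi)) • (y - x)) := by
  have h := Measure.integral_comp_smul (volume : Measure E)
    (fun ξ => Complex.exp (Complex.I * (inner ℝ (x - y) ξ : ℝ)) * β (x, ξ)) R
  have e : 𝓕 (fun ξ => β (x, R • ξ)) ((R / (2 * Real.pi)) • (y - x)) =
      ∫ ξ, Complex.exp (Complex.I * (inner ℝ (x - y) (R • ξ) : ℝ)) * β (x, R • ξ) := by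
    rw [Real.fourier_eq']
    refine integral_congr_ae (Eventually.of_forall fun ξ => ?_)
    have e1 : -2 * Real.pi * inner ℝ ξ ((R / (2 * Real.pi)) • (y - x)) =
        inner ℝ (x - y) (R • ξ) := by
      rw [inner_smul_right, inner_smul_right, real_inner_comm, ← neg_sub x y, inner_neg_left]
      field_simp
    simp only [smul_eq_mul]
    rw [e1, mul_comm Complex.I]
  rw [e, h, symbolKernel, abs_of_pos (by positivity), Complex.real_smul, ← mul_assoc,
    ← Complex.ofReal_mul]
  congr 3
  rw [div_pow]
  field_simp

lemma stronglyMeasurable_symbolKernel {β : E × E → ℂ} (hβ : StronglyMeasurable β) :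
    StronglyMeasurable (symbolKernel β) := by
  have h1 : StronglyMeasurable fun q : (E × E) × E =>
      Complex.exp (Complex.I * (inner ℝ (q.1.1 - q.1.2) q.2 : ℝ)) * β (q.1.1, q.2) := by
    refine StronglyMeasurable.mul (Continuous.stronglyMeasurable (by fun_prop)) ?_
    exact hβ.comp_measurable (by fun_prop)
  exact (h1.integral_prod_right' (ν := (volume : Measure E))).const_mul _

lemma norm_symbolKernel_le (β : E × E → ℂ) (x y : E) :
    ‖symbolKernel β (x, y)‖ ≤ ((2 * Real.pi) ^ Module.finrank ℝ E)⁻¹ * ∫ ξ, ‖β (x, ξ)‖ := by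
  rw [symbolKernel, norm_mul, Complex.norm_real, Real.norm_of_nonneg (by positivity)]
  refine mul_le_mul_of_nonneg_left ((norm_integral_le_integral_norm _).trans (le_of_eq ?_))
    (by positivity)
  simp only [norm_mul, norm_exp_I_mul_inner, one_mul]

/-- The kernel is bounded, uniformly in `y`, by a multiple of `∫ |β(x, ξ)| dξ`, which is locally
integrable in `x`; bounded sets of `y` have finite measure. -/
lemma locallyIntegrable_symbolKernel {β : E × E → ℂ} (hm : StronglyMeasurable β)
    (hβ : LocallyIntegrable β) {R : ℝ}
    (h0 : ∀ x ξ, ξ ∉ Metric.closedBall (0 : E) R → β (x, ξ) = 0) :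
    LocallyIntegrable (symbolKernel β) := by
  rw [locallyIntegrable_iff]
  intro K hK
  obtain ⟨r, hr⟩ := hK.isBounded.subset_closedBall (0 : E × E)
  have h1 : K ⊆ Metric.closedBall (0 : E) r ×ˢ Metric.closedBall (0 : E) r := by
    rwa [closedBall_prod_same]
  refine IntegrableOn.mono_set ?_ h1
  rw [IntegrableOn, Measure.volume_eq_prod, ← Measure.prod_restrict]
  have : IsFiniteMeasure ((volume : Measure E).restrict (Metric.closedBall 0 r)) :=
    ⟨by rw [Measure.restrict_apply_univ]; exact measure_closedBall_lt_top⟩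
  have h2 := (integrable_restrict_prod_of_eq_zero hβ h0 r).integral_norm_prod_left
  refine ((h2.const_mul ((2 * Real.pi) ^ Module.finrank ℝ E)⁻¹).comp_fst
    ((volume : Measure E).restrict (Metric.closedBall 0 r))).mono'
    (stronglyMeasurable_symbolKernel hm).aestronglyMeasurable (Eventually.of_forall fun p => ?_)
  exact norm_symbolKernel_le β p.1 p.2

lemma partialFourierInvSchwartz_shear_apply (ψ : 𝓢(E × E, ℂ)) (x ζ : E) :
    partialFourierInvSchwartz
      (SchwartzMap.compCLMOfContinuousLinearEquiv ℂ PartialFourier.shear ψ) (x, ζ) =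
      ((((2 * Real.pi) ^ Module.finrank ℝ E)⁻¹ : ℝ) : ℂ) *
        ∫ y, Complex.exp (Complex.I * (inner ℝ (x - y) ζ : ℝ)) * ψ (x, y) := by
  rw [partialFourierInvSchwartz_apply, ← integral_sub_left_eq_self (μ := (volume : Measure E)) _ x]
  congr 1
  refine integral_congr_ae (Eventually.of_forall fun y => ?_)
  simp [PartialFourier.shear_apply]

/-- Fubini in `(ζ, y)` for fixed `x`; the phase has modulus one, so integrability of the slice of
`β` suffices. -/
lemma integral_slice_mul_partialFourierInv (β : E × E → ℂ) (ψ : 𝓢(E × E, ℂ)) (x : E)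
    (hx : Integrable fun ξ => β (x, ξ)) :
    ∫ ζ, β (x, ζ) * partialFourierInvSchwartz
      (SchwartzMap.compCLMOfContinuousLinearEquiv ℂ PartialFourier.shear ψ) (x, ζ) =
      ∫ y, symbolKernel β (x, y) * ψ (x, y) := by
  set c : ℂ := ((((2 * Real.pi) ^ Module.finrank ℝ E)⁻¹ : ℝ) : ℂ) with hc
  have hψ : Integrable fun y => ψ (x, y) := (PartialFourier.slice x ψ).integrable
  have hint : Integrable (Function.uncurry fun (ζ y : E) =>
      Complex.exp (Complex.I * (inner ℝ (x - y) ζ : ℝ)) * (c * β (x, ζ) * ψ (x, y)))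
      ((volume : Measure E).prod volume) := by
    refine ((hx.const_mul c).mul_prod hψ).bdd_mul (c := 1) ?_ (Eventually.of_forall fun p => ?_)
    · exact Continuous.aestronglyMeasurable (by fun_prop)
    · exact (norm_exp_I_mul_inner _ _).le
  calc _ = ∫ ζ, ∫ y, Complex.exp (Complex.I * (inner ℝ (x - y) ζ : ℝ)) *
        (c * β (x, ζ) * ψ (x, y)) := by
        refine integral_congr_ae (Eventually.of_forall fun ζ => ?_)
        beta_reduce
        rw [partialFourierInvSchwartz_shear_apply, ← mul_assoc, ← integral_const_mul]
        refine integral_congr_ae (Eventually.of_forall fun y => ?_)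
        beta_reduce
        ring
    _ = ∫ y, ∫ ζ, Complex.exp (Complex.I * (inner ℝ (x - y) ζ : ℝ)) *
        (c * β (x, ζ) * ψ (x, y)) := integral_integral_swap hint
    _ = _ := by
        refine integral_congr_ae (Eventually.of_forall fun y => ?_)
        beta_reduce
        rw [symbolKernel, mul_assoc, ← integral_mul_const, ← integral_const_mul]
        refine integral_congr_ae (Eventually.of_forall fun ζ => ?_)
        beta_reduce
        ring

/-- The distribution kernel is given by the kernel function of the symbol. -/
lemma isGivenBy_symbolKernel {B : 𝓢'(E × E, ℂ)} {β : E × E → ℂ} (hm : StronglyMeasurable β)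
    (hβ : IsGivenBy B β) {R : ℝ} (hB : dsupport B ⊆ univ ×ˢ Metric.closedBall 0 R)
    (h0 : ∀ x ξ, ξ ∉ Metric.closedBall (0 : E) R → β (x, ξ) = 0) :
    IsGivenBy (distributionKernel B) (symbolKernel β) := by
  have hK := locallyIntegrable_symbolKernel hm hβ.1 h0
  refine ⟨hK, fun ψ hψ => ?_⟩
  set Φ := partialFourierInvSchwartz
    (SchwartzMap.compCLMOfContinuousLinearEquiv ℂ PartialFourier.shear ψ) with hΦ
  -- The transformed test function `Φ` need not have compact support in `ξ`, whereas `IsGivenBy`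
  -- only tests compactly supported functions. A cutoff in `ξ` equal to one near the support of `B`
  -- changes neither `B Φ` nor `β Φ`; compactness in `x` is inherited from `ψ`.
  obtain ⟨χ, hχ, hχc, hχ1⟩ := exists_contDiff_cutoff (E := E) R
  have hχt : (fun p : E × E => χ p.2).HasTemperateGrowth :=
    (hχc.hasTemperateGrowth hχ).comp (ContinuousLinearMap.snd ℝ E E).hasTemperateGrowth
  set Φ' := SchwartzMap.smulLeftCLM ℂ (fun p : E × E => χ p.2) Φ with hΦ'
  have hΦ'a : ∀ p, Φ' p = χ p.2 * Φ p := fun p => SchwartzMap.smulLeftCLM_apply_apply hχt _ _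
  have hBΦ : distributionKernel B ψ = B Φ' := by
    rw [hΦ', apply_smulLeftCLM_eq_of_eq_one B (fun p : E × E => χ p.2) hχt
      (Metric.isOpen_ball.preimage continuous_snd)
      (fun p hp => closedBall_subset_ball_abs_add_one R (hB hp).2) (fun p hp => hχ1 _ hp)]
    rfl
  have hc : HasCompactSupport Φ' := by
    refine HasCompactSupport.intro ((hψ.isCompact.image continuous_fst).prod hχc.isCompact)
      fun p hp => ?_
    rw [hΦ'a]
    by_cases h2 : p.2 ∈ tsupport χ
    · have h1 : p.1 ∉ Prod.fst '' tsupport ψ := fun h1 => hp ⟨h1, h2⟩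
      have h3 : ∀ y, ψ (p.1, y) = 0 := fun y =>
        image_eq_zero_of_notMem_tsupport fun h => h1 ⟨(p.1, y), h, rfl⟩
      have h4 : Φ p = 0 := by
        have := partialFourierInvSchwartz_shear_apply ψ p.1 p.2
        simpa [h3] using this
      rw [h4, mul_zero]
    · rw [image_eq_zero_of_notMem_tsupport h2, zero_mul]
  have hfun : (fun p => β p * Φ' p) = fun p => β p * Φ p := by
    ext p
    by_cases h : p.2 ∈ Metric.closedBall (0 : E) R
    · rw [hΦ'a, hχ1 _ (closedBall_subset_ball_abs_add_one R h), one_mul]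
    · rw [show β p = 0 from h0 p.1 p.2 h, zero_mul, zero_mul]
  have hi1 : Integrable (fun p => β p * Φ p) := by
    rw [← hfun]
    have := hβ.1.integrable_smul_left_of_hasCompactSupport Φ'.continuous hc
    simpa only [smul_eq_mul, mul_comm] using this
  have hi2 : Integrable (fun p => symbolKernel β p * ψ p) := by
    have := hK.integrable_smul_left_of_hasCompactSupport ψ.continuous hψ
    simpa only [smul_eq_mul, mul_comm] using this
  rw [hBΦ, hβ.2 Φ' hc, hfun]
  rw [Measure.volume_eq_prod] at hi1 hi2 ⊢
  rw [integral_prod _ hi1, integral_prod _ hi2]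
  refine integral_congr_ae ?_
  filter_upwards [ae_integrable_slice hβ.1 h0] with x hx
  exact integral_slice_mul_partialFourierInv β ψ x hx

end Kernel

/-! ### Marschall's inequality. -/

section Marschall

variable {E : Type} [NormedAddCommGroup E] [InnerProductSpace ℝ E] [FiniteDimensional ℝ E]
  [MeasurableSpace E] [BorelSpace E]

lemma ae_comp_smul {p : E → Prop} (h : ∀ᵐ ξ : E, p ξ) {R : ℝ} (hR : R ≠ 0) :
    ∀ᵐ ξ : E, p (R • ξ) := by
  have hq : Measure.QuasiMeasurePreserving (fun ξ : E => R • ξ) volume volume :=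
    ⟨measurable_const_smul R, by
      rw [Measure.map_addHaar_smul _ hR]
      exact Measure.smul_absolutelyContinuous⟩
  exact hq.ae h

/-- The norm depends on `f` only through `𝓕 f`, so the measurable representative may replace the
symbol on almost every slice. -/
lemma homBesovNorm_congr_ae (Ψ : ℝ → ℝ) (s : ℝ) (p : ℝ≥0∞) (q : ℝ) {f g : E → ℂ}
    (h : f =ᵐ[volume] g) : homBesovNorm Ψ s p q f = homBesovNorm Ψ s p q g := by
  have : 𝓕 f = 𝓕 g := funext fun ξ => Real.fourier_congr_ae h ξ
  simp only [homBesovNorm, lpPiece, this]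

/-- Turns the local integrability assumed of the majorant into its finiteness almost everywhere,
hence into integrability of `K(x, ·) v`. -/
lemma LocallyIntegrable.ae_lt_top {f : E → ℝ≥0∞} (hf : LocallyIntegrable f) :
    ∀ᵐ x : E, f x < ⊤ := by
  obtain ⟨u, -, hu, hfu⟩ := hf.exists_nat_integrableOn
  rw [← Measure.restrict_univ (μ := (volume : Measure E)), ← hu, ae_restrict_iUnion_iff]
  intro n
  refine ae_lt_top' (hfu n).aestronglyMeasurable.aemeasurable ?_
  have := (hfu n).2
  simpa only [HasFiniteIntegral, enorm_eq_self] using this.ne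

lemma dsupport_fourier_subset_of_fourierSpectrum_subset {V : 𝓢'(E, ℂ)} {R : ℝ}
    (hV : fourierSpectrum V ⊆ Metric.closedBall 0 R) :
    dsupport (𝓕 V : 𝓢'(E, ℂ)) ⊆ Metric.closedBall 0 (R / (2 * Real.pi)) := by
  intro ξ hξ
  have h1 : (2 * Real.pi) • ξ ∈ fourierSpectrum V := by
    rw [fourierSpectrum, mem_ofPred_eq, smul_smul, inv_mul_cancel₀ (by positivity), one_smul]
    exact hξ
  have h2 := hV h1
  rw [mem_closedBall_zero_iff, norm_smul, Real.norm_of_nonneg (by positivity)] at h2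
  rw [mem_closedBall_zero_iff, le_div_iff₀ (by positivity)]
  linarith

/-- The absolute form of Marschall's inequality. -/
lemma ae_lintegral_kernel_mul_le [Nontrivial E] {Ψ : ℝ → ℝ} (hΨ : IsLPCutoff Ψ) {t : ℝ}
    (ht0 : 0 < t) (ht1 : t ≤ 1) {R : ℝ} (hR : 0 < R) {B : 𝓢'(E × E, ℂ)} {b K : E × E → ℂ}
    {V : 𝓢'(E, ℂ)} {v : E → ℂ} (hb : IsGivenBy B b)
    (hB : dsupport B ⊆ univ ×ˢ Metric.closedBall 0 R) (hK : IsGivenBy (distributionKernel B) K)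
    (hV : fourierSpectrum V ⊆ Metric.closedBall 0 R) (hv : IsGivenBy V v) :
    ∀ᵐ x : E, ∫⁻ y, ‖K (x, y) * v y‖ₑ ≤ marschallConst E t * (maximalFunction t v x *
      homBesovNorm Ψ (Module.finrank ℝ E / t) 1 t (fun ξ => b (x, R • ξ))) := by
  obtain ⟨β, hβm, hbβ, hβ, hβ0⟩ := exists_stronglyMeasurable_symbol hb hB
  have hK' : K =ᵐ[volume] symbolKernel β :=
    isGivenBy_ae_eq hK (isGivenBy_symbolKernel hβm hβ hB hβ0)
  have hV' := dsupport_fourier_subset_of_fourierSpectrum_subset hV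
  obtain ⟨v₀, hv₀, hv₀'⟩ := exists_function_of_dsupport_fourier_subset V hV'
  have hvv : v₀ =ᵐ[volume] v := isGivenBy_ae_eq ⟨hv₀, fun ψ _ => (hv₀' ψ).2⟩ hv
  have hva : ∀ ψ : 𝓢(E, ℂ), Integrable (fun x => v x * ψ x) ∧ V ψ = ∫ x, v x * ψ x := by
    intro ψ
    have h : (fun x => v₀ x * ψ x) =ᵐ[volume] fun x => v x * ψ x := by
      filter_upwards [hvv] with x hx
      rw [hx]
    exact ⟨(hv₀' ψ).1.congr h, (hv₀' ψ).2.trans (integral_congr_ae h)⟩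
  -- Equality almost everywhere on the product holds, for almost every `x`, at almost every point of
  -- the slice; the remaining argument works slice by slice.
  rw [Measure.volume_eq_prod] at hK' hbβ
  have ha : 0 < R / (2 * Real.pi) := by positivity
  filter_upwards [Measure.ae_ae_of_ae_prod hK', Measure.ae_ae_of_ae_prod hbβ,
    ae_integrable_slice hβ.1 hβ0] with x hx1 hx2 hx3
  have hh : Integrable fun ξ => β (x, R • ξ) := hx3.comp_smul hR.ne'
  have hs : ∀ᵐ ξ : E, ξ ∉ Metric.closedBall (0 : E) 1 → β (x, R • ξ) = 0 := by
    refine Eventually.of_forall fun ξ hξ => hβ0 x _ fun h => hξ ?_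
    rw [mem_closedBall_zero_iff, norm_smul, Real.norm_of_nonneg hR.le] at h
    rw [mem_closedBall_zero_iff]
    exact le_of_mul_le_mul_left (by simpa using h) hR
  rw [homBesovNorm_congr_ae Ψ _ 1 t (ae_comp_smul hx2 hR.ne'), mul_comm (maximalFunction t v x)]
  refine le_trans (le_of_eq ?_) (lintegral_fourier_mul_le_besov_mul_maximal hΨ hh ha x hs hV'
    hv.1.aestronglyMeasurable hva ht0 ht1)
  rw [← lintegral_const_mul' _ _ ENNReal.ofReal_ne_top]
  refine lintegral_congr_ae ?_
  filter_upwards [hx1] with y hy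
  rw [hy, symbolKernel_eq_fourier β hR, mul_assoc, enorm_mul]
  congr 1
  rw [← ofReal_norm, Complex.norm_real, Real.norm_of_nonneg (by positivity)]

end Marschall

theorem mainTheorem5 (n : ℕ) (hn : 0 < n) (Ψ : ℝ → ℝ) (hΨ : IsLPCutoff Ψ) :
    (∀ (k : ℤ)
      (B : 𝓢'(EuclideanSpace ℝ (Fin n) × EuclideanSpace ℝ (Fin n), ℂ))
      (b : EuclideanSpace ℝ (Fin n) × EuclideanSpace ℝ (Fin n) → ℂ),
      IsGivenBy B b →
      dsupport B ⊆ univ ×ˢ Metric.closedBall 0 ((2 : ℝ) ^ k) →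
      ∃ K : EuclideanSpace ℝ (Fin n) × EuclideanSpace ℝ (Fin n) → ℂ,
        IsGivenBy (distributionKernel B) K) ∧
    (∀ (k : ℤ) (V : 𝓢'(EuclideanSpace ℝ (Fin n), ℂ)),
      fourierSpectrum V ⊆ Metric.closedBall 0 ((2 : ℝ) ^ k) →
      ∃ v : EuclideanSpace ℝ (Fin n) → ℂ, IsGivenBy V v) ∧
    (∀ t : ℝ, 0 < t → t ≤ 1 →
      ∃ c : ℝ≥0, ∀ (k : ℤ)
        (B : 𝓢'(EuclideanSpace ℝ (Fin n) × EuclideanSpace ℝ (Fin n), ℂ))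
        (b K : EuclideanSpace ℝ (Fin n) × EuclideanSpace ℝ (Fin n) → ℂ)
        (V : 𝓢'(EuclideanSpace ℝ (Fin n), ℂ)) (v : EuclideanSpace ℝ (Fin n) → ℂ),
        IsGivenBy B b →
        dsupport B ⊆ univ ×ˢ Metric.closedBall 0 ((2 : ℝ) ^ k) →
        IsGivenBy (distributionKernel B) K →
        fourierSpectrum V ⊆ Metric.closedBall 0 ((2 : ℝ) ^ k) →
        IsGivenBy V v →
        LocallyIntegrable (fun x => maximalFunction t v x *
          homBesovNorm Ψ (n / t) 1 t (fun ξ => b (x, (2 : ℝ) ^ k • ξ))) →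
        (∀ᵐ x, Integrable (fun y => K (x, y) * v y)) ∧
        LocallyIntegrable (kernelAction K v) ∧
        (∀ᵐ x, ‖kernelAction K v x‖ₑ ≤
          c * homBesovNorm Ψ (n / t) 1 t (fun ξ => b (x, (2 : ℝ) ^ k • ξ)) *
            maximalFunction t v x)) := by
  have hE : Module.finrank ℝ (EuclideanSpace ℝ (Fin n)) = n := finrank_euclideanSpace_fin
  have : Nontrivial (EuclideanSpace ℝ (Fin n)) :=
    Module.nontrivial_of_finrank_pos (R := ℝ) (by rw [hE]; exact hn)
  refine ⟨fun k B b hb hB => ?_, fun k V hV => ?_, fun t ht0 ht1 => ?_⟩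
  · obtain ⟨β, hβm, -, hβ, hβ0⟩ := exists_stronglyMeasurable_symbol hb hB
    exact ⟨_, isGivenBy_symbolKernel hβm hβ hB hβ0⟩
  · obtain ⟨v, hv, hv'⟩ := exists_function_of_dsupport_fourier_subset V
      (dsupport_fourier_subset_of_fourierSpectrum_subset hV)
    exact ⟨v, hv, fun ψ _ => (hv' ψ).2⟩
  -- The constant involves only `n` and `t`, not even `Ψ`.
  refine ⟨(marschallConst (EuclideanSpace ℝ (Fin n)) t).toNNReal, fun k B b K V v hb hB hK hV hv hF => ?_⟩
  have hC := marschallConst_ne_top (E := EuclideanSpace ℝ (Fin n)) ht0 ht1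
  rw [ENNReal.coe_toNNReal hC]
  have key := ae_lintegral_kernel_mul_le hΨ ht0 ht1 (zpow_pos two_pos k) hb hB hK hV hv
  rw [hE] at key
  have hm : AEStronglyMeasurable (fun p : EuclideanSpace ℝ (Fin n) × EuclideanSpace ℝ (Fin n) =>
      K p * v p.2) (volume.prod volume) := by
    have h1 := hK.1.aestronglyMeasurable
    rw [Measure.volume_eq_prod] at h1
    exact h1.mul hv.1.aestronglyMeasurable.comp_snd
  have hle : ∀ᵐ x, ‖kernelAction K v x‖ₑ ≤ marschallConst (EuclideanSpace ℝ (Fin n)) t *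
      (maximalFunction t v x *
        homBesovNorm Ψ (n / t) 1 t (fun ξ => b (x, (2 : ℝ) ^ k • ξ))) := by
    filter_upwards [key] with x hx
    exact (enorm_integral_le_lintegral_enorm _).trans hx
  refine ⟨?_, ?_, ?_⟩
  · filter_upwards [key, LocallyIntegrable.ae_lt_top hF, hm.prodMk_left] with x hx hfin hxm
    exact ⟨hxm, hx.trans_lt (ENNReal.mul_lt_top (lt_top_iff_ne_top.2 hC) hfin)⟩
  · have hmK : AEStronglyMeasurable (kernelAction K v) := hm.integral_prod_right'
    intro x
    obtain ⟨s, hs, hFs⟩ := hF x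
    refine ⟨s, hs, hmK.restrict, ?_⟩
    have h1 := hFs.2
    simp only [HasFiniteIntegral, enorm_eq_self] at h1 ⊢
    refine (lintegral_mono_ae (ae_restrict_of_ae hle)).trans_lt ?_
    rw [lintegral_const_mul' _ _ hC]
    exact ENNReal.mul_lt_top (lt_top_iff_ne_top.2 hC) h1
  · filter_upwards [hle] with x hx
    rw [mul_assoc, mul_comm (homBesovNorm _ _ _ _ _)]
    exact hx
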